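/- Let $m\ge 0$ and let $t=(t_1,\dots,t_m)$ be the affine coordinates on the chart $\mathbb C^m=\{[1:t_1:\dots:t_m]\}\subset\mathbb CP^m$. A \emph{Pfaffian system defined over $\mathbb Q$} on $\mathbb CP^m$ is a system $dX=\Omega X$ with $\Omega=\sum_{k=1}^m A_k\,dt_k$, where $A_1,\dots,A_m$ are $n\times n$ matrices over $\mathbb Q(t_1,\dots,t_m)$; its polar locus $\Sigma\subset\mathbb CP^m$ is the set of points at which the rational matrix $1$-form $\Omega$ on $\mathbb CP^m$ is not regular. The system is a \emph{Q-system} if it is (i) \emph{flat}: $d\Omega=\Omega\wedge\Omega$ outside $\Sigma$; (ii) \emph{regular}: for every simply connected semialgebraic set $U\subset\mathbb CP^m\smallsetminus\Sigma$ and every nondegenerate matrix solution $X$ on $U$ there are $C$ and $N$ such that $|X(z)|+|X(z)^{-1}|\le C\operatorname{dist}(z,\Sigma)^{-N}$ for all $z\in U$ (where $\operatorname{dist}(\cdot,\varnothing)=1$ by convention); (iii) \emph{quasiunipotent}: for every map $\gamma$ to $\mathbb CP^m$, holomorphic near a closed disc $\{|z|\le\varepsilon\}$, with $\gamma(0)\in\Sigma$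 and $\gamma(z)\notin\Sigma$ for $0<|z|\le\varepsilon$, all eigenvalues of the monodromy matrix $M$ of the loop $\gamma(\{|z|=\varepsilon\})$ are roots of unity; here $M$ is defined by the condition that continuation along the loop carries a nondegenerate matrix solution $X$ to $XM$. A \emph{multivalued analytic function} on $\mathbb CP^m$ is a holomorphic function $f:E\to\mathbb C$ on a connected space $E$ with a local homeomorphism $\pi:E\to\mathbb CP^m$ (holomorphic meaning that locally $f=g\circ\pi$ with $g$ holomorphic). It is an \emph{algebraic function defined over $\mathbb Q$} if there is a nonzero polynomial $P\in\mathbb Q[t_1,\dots,t_m,y]$ such that $P(t,f(e))=0$ for all $e\in E$ with $\pi(e)=[1:t]$ in the affine chart. It is a \emph{Q-function} if it is a linear combination of components of a matrix solution of a Q-system: there are a Q-system of some size $n$, with polar locus $\Sigma$, and constants $c_{ij}\in\mathbb C$ such that near every $e\in E$ with $\pi(e)\notin\Sigma$ one has $f=\sum_{i,j=1}^n c_{ij}\,X_{ij}\circ\pi$ for some nondegenerate matrix solution $X$ of the system near $\pi(e)$. \textbf{Proposition.} Every algebraic function defined over $\mathbb Q$ is a Q-function. -/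

import Mathlib

universe u

open Topology

noncomputable section

/-! ### Complex projective space -/

/-- Complex projective space `ℂPᵐ`; its points are written `[z₀ : ⋯ : zₘ]`. -/
abbrev CP (m : ℕ) : Type := Projectivization ℂ (Fin (m + 1) → ℂ)

/-- The quotient topology of `ℂPᵐ = (ℂᵐ⁺¹ ∖ 0) / ℂˣ`. -/
instance CP.topology (m : ℕ) : TopologicalSpace (CP m) :=
  TopologicalSpace.coinduced
    (fun v : {v : Fin (m + 1) → ℂ // v ≠ 0} => Projectivization.mk ℂ v.1 v.2) inferInstance

/-- The point `[1 : t₁ : ⋯ : tₘ]` of the affine chart `ℂᵐ ⊂ ℂPᵐ`. -/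
def CP.affine {m : ℕ} (t : Fin m → ℂ) : CP m :=
  Projectivization.mk ℂ (Fin.cons 1 t : Fin (m + 1) → ℂ) fun h => by
    simpa using congrFun h 0

/-- The function `z ↦ f [z]` on `ℂᵐ⁺¹ ∖ 0` (extended by `0` to the origin). -/
def CP.pullback {m : ℕ} {E : Type*} [Zero E] (f : CP m → E) (z : Fin (m + 1) → ℂ) : E :=
  open Classical in if h : z ≠ 0 then f (Projectivization.mk ℂ z h) else 0

/-- A scalar function on `ℂPᵐ` is holomorphic at `p`. -/
def CP.HolomorphicAt {m : ℕ} (f : CP m → ℂ) (p : CP m) : Prop :=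
  ∀ (z : Fin (m + 1) → ℂ) (hz : z ≠ 0), Projectivization.mk ℂ z hz = p →
    AnalyticAt ℂ (CP.pullback f) z

/-- The punctured cone in `ℂᵐ⁺¹ ∖ 0` over a subset of `ℂPᵐ`. -/
def CP.cone {m : ℕ} (S : Set (CP m)) : Set (Fin (m + 1) → ℂ) :=
  {z | ∃ h : z ≠ 0, Projectivization.mk ℂ z h ∈ S}

/-- The distance from a point `p = [z]` to a subset `S` of `ℂPᵐ`, namely `dist (z, Ŝ) / ‖z‖` where
`Ŝ` is the cone over `S` with its vertex `0`. It does not depend on the choice of `z`, and up to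
constant factors it is the Fubini–Study distance (and is `1` for `S = ∅`). -/
def CP.distTo {m : ℕ} (p : CP m) (S : Set (CP m)) : ℝ :=
  Metric.infDist p.rep (insert 0 (CP.cone S)) / ‖p.rep‖

/-! ### Semialgebraic sets -/

/-- Semialgebraic subsets of `ℂᵏ = ℝ²ᵏ`: Boolean combinations of sets defined by strict
inequalities `g > 0` between real polynomials in the real and imaginary parts of the coordinates. -/
inductive IsSemialgebraic {k : ℕ} : Set (Fin k → ℂ) → Prop
  | basic (g : MvPolynomial (Fin k ⊕ Fin k) ℝ) :
      IsSemialgebraic {z | 0 < MvPolynomial.eval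
        (Sum.elim (fun a => (z a).re) (fun a => (z a).im)) g}
  | compl {S : Set (Fin k → ℂ)} : IsSemialgebraic S → IsSemialgebraic Sᶜ
  | inter {S T : Set (Fin k → ℂ)} :
      IsSemialgebraic S → IsSemialgebraic T → IsSemialgebraic (S ∩ T)

/-- A subset of `ℂPᵐ` is semialgebraic if the cone over it is. -/
def CP.IsSemialgebraic {m : ℕ} (U : Set (CP m)) : Prop :=
  _root_.IsSemialgebraic (CP.cone U)

/-! ### Rational functions over `ℚ` -/

/-- The field `ℚ(x₁, …, x_k)`. -/
abbrev RatFun (k : ℕ) : Type := FractionRing (MvPolynomial (Fin k) ℚ)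

/-- The reduced denominator of a rational function. -/
def RatFun.den {k : ℕ} (r : RatFun k) : MvPolynomial (Fin k) ℚ :=
  (IsFractionRing.den (MvPolynomial (Fin k) ℚ) r : MvPolynomial (Fin k) ℚ)

/-- The reduced numerator of a rational function. -/
def RatFun.num {k : ℕ} (r : RatFun k) : MvPolynomial (Fin k) ℚ :=
  IsFractionRing.num (MvPolynomial (Fin k) ℚ) r

/-- A rational function is regular at the complex point `z`, i.e. its reduced denominator does not
vanish there. -/
def RatFun.RegularAt {k : ℕ} (r : RatFun k) (z : Fin k → ℂ) : Prop :=
  MvPolynomial.aeval z r.den ≠ 0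

/-- The value of a rational function at a complex point at which it is regular. -/
def RatFun.value {k : ℕ} (r : RatFun k) (z : Fin k → ℂ) : ℂ :=
  MvPolynomial.aeval z r.num / MvPolynomial.aeval z r.den

/-- The coordinate `z_a` as a rational function. -/
def RatFun.coord {k : ℕ} (a : Fin k) : RatFun k :=
  algebraMap (MvPolynomial (Fin k) ℚ) (RatFun k) (MvPolynomial.X a)

/-- The substitution `t_k = z_k / z₀` in a polynomial. -/
def homogenizePoly (m : ℕ) : MvPolynomial (Fin m) ℚ →ₐ[ℚ] RatFun (m + 1) :=
  MvPolynomial.aeval fun k => RatFun.coord k.succ / RatFun.coord 0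

theorem homogenizePoly_injective (m : ℕ) : Function.Injective (homogenizePoly m) := by
  have h0 : (RatFun.coord 0 : RatFun (m + 1)) ≠ 0 := by
    intro h
    refine MvPolynomial.X_ne_zero (R := ℚ) (0 : Fin (m + 1)) ?_
    exact IsFractionRing.injective (MvPolynomial (Fin (m + 1)) ℚ) (RatFun (m + 1))
      (h.trans (map_zero _).symm)
  have key : ∀ p : MvPolynomial (Fin m) ℚ, ∃ (N : ℕ) (q : MvPolynomial (Fin (m + 1)) ℚ),
      (RatFun.coord 0) ^ N * homogenizePoly m p = algebraMap _ (RatFun (m + 1)) q ∧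
      ∀ a : Fin m → ℚ, MvPolynomial.eval (Fin.cons 1 a : Fin (m + 1) → ℚ) q =
        MvPolynomial.eval a p := by
    intro p
    induction p using MvPolynomial.induction_on with
    | C c =>
      refine ⟨0, MvPolynomial.C c, ?_, ?_⟩
      · simp only [pow_zero, one_mul, homogenizePoly, MvPolynomial.aeval_C]
        rw [← MvPolynomial.algebraMap_eq, ← IsScalarTower.algebraMap_apply]
      · simp
    | add p p' hp hp' =>
      obtain ⟨N, q, h, e⟩ := hp
      obtain ⟨N', q', h', e'⟩ := hp'
      refine ⟨N + N', MvPolynomial.X 0 ^ N' * q + MvPolynomial.X 0 ^ N * q', ?_, ?_⟩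
      · simp only [map_add, map_mul, map_pow, ← h, ← h']
        change _ = (RatFun.coord 0) ^ N' * _ + (RatFun.coord 0) ^ N * _
        ring
      · intro a
        simp [e, e']
    | mul_X p k hp =>
      obtain ⟨N, q, h, e⟩ := hp
      refine ⟨N + 1, q * MvPolynomial.X k.succ, ?_, ?_⟩
      · have hX : homogenizePoly m (MvPolynomial.X k) =
            RatFun.coord k.succ / RatFun.coord 0 := by
          simp [homogenizePoly]
        rw [map_mul, map_mul, ← h, hX]
        change _ = _ * RatFun.coord k.succ
        rw [pow_succ, mul_assoc, mul_assoc, mul_left_comm (RatFun.coord 0),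
          mul_div_cancel₀ _ h0]
      · intro a
        simp [e]
  rw [injective_iff_map_eq_zero]
  intro p hp
  obtain ⟨N, q, h, e⟩ := key p
  rw [hp, mul_zero] at h
  have hq : q = 0 :=
    IsFractionRing.injective (MvPolynomial (Fin (m + 1)) ℚ) (RatFun (m + 1)) (by rw [← h, map_zero])
  apply MvPolynomial.funext
  intro a
  rw [← e a, hq]
  simp

/-- The substitution `t_k = z_k / z₀`: a rational function of the affine coordinates `t` as a
rational function of the homogeneous coordinates `z`. -/
def homogenize (m : ℕ) : RatFun m →ₐ[ℚ] RatFun (m + 1) :=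
  IsFractionRing.liftAlgHom (g := homogenizePoly m) (homogenizePoly_injective m)

/-! ### Pfaffian systems on `ℂPᵐ` defined over `ℚ` -/

/-- A Pfaffian system `dX = Ω X` on `ℂPᵐ` defined over `ℚ`: the rational matrix `1`-form is
`Ω = ∑ₖ Aₖ dtₖ` in the affine chart, with `n × n` matrices `Aₖ` over `ℚ(t₁, …, tₘ)`. -/
structure PfaffianSystem (m n : ℕ) where
  /-- The matrix coefficient `Aₖ` of `dtₖ`. -/
  coeff : Fin m → Matrix (Fin n) (Fin n) (RatFun m)

namespace PfaffianSystem

variable {m n : ℕ} (Ω : PfaffianSystem m n)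

/-- The coefficients of `Ω` in homogeneous coordinates: the pull-back of `Ω` to `ℂᵐ⁺¹ ∖ 0` is
`∑ₐ Bₐ dzₐ`, where by `dtₖ = dzₖ / z₀ - zₖ dz₀ / z₀²` one has
`B₀ = - ∑ₖ (zₖ / z₀²) Aₖ(z / z₀)` and `Bₖ = (1 / z₀) Aₖ(z / z₀)` for `k ≥ 1`. -/
def homCoeff (a : Fin (m + 1)) (i j : Fin n) : RatFun (m + 1) :=
  Fin.cases
    (-∑ k : Fin m, RatFun.coord k.succ / RatFun.coord 0 ^ 2 * homogenize m (Ω.coeff k i j))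
    (fun k => homogenize m (Ω.coeff k i j) / RatFun.coord 0) a

/-- The polar locus `Σ ⊂ ℂPᵐ` of `Ω` (it contains the hyperplane at infinity, or meets it in a
proper subset, according to whether `Ω` has a pole along it). -/
def polarLocus : Set (CP m) :=
  {p | ∃ (z : Fin (m + 1) → ℂ) (hz : z ≠ 0), Projectivization.mk ℂ z hz = p ∧
    ∃ a i j, ¬ (Ω.homCoeff a i j).RegularAt z}

/-- The matrix function `X` satisfies `dX = Ω X` at the point `p`. -/
def SolvesAt (X : CP m → Matrix (Fin n) (Fin n) ℂ) (p : CP m) : Prop :=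
  ∀ (z : Fin (m + 1) → ℂ) (hz : z ≠ 0), Projectivization.mk ℂ z hz = p →
    ∀ i j, HasFDerivAt (CP.pullback fun q => X q i j)
      (∑ a, (∑ l, (Ω.homCoeff a i l).value z * X p l j) •
        ContinuousLinearMap.proj (R := ℂ) (φ := fun _ : Fin (m + 1) => ℂ) a) z

/-- `X` is a (holomorphic, nondegenerate) fundamental matrix solution in a neighbourhood of `p`. -/
def IsFundamentalNear (X : CP m → Matrix (Fin n) (Fin n) ℂ) (p : CP m) : Prop :=
  ∀ᶠ q in 𝓝 p, Ω.SolvesAt X q ∧ (X q).det ≠ 0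

/-- Flatness (local integrability) `dΩ = Ω ∧ Ω` outside the polar locus, in homogeneous
coordinates: `∂ₐ B_b - ∂_b Bₐ = Bₐ B_b - B_b Bₐ`. -/
def IsFlat : Prop :=
  ∀ z ∈ CP.cone Ω.polarLocusᶜ, ∀ (a b : Fin (m + 1)) (i j : Fin n),
    fderiv ℂ (fun w => (Ω.homCoeff b i j).value w) z (Pi.single a 1) -
      fderiv ℂ (fun w => (Ω.homCoeff a i j).value w) z (Pi.single b 1) =
    ∑ l, ((Ω.homCoeff a i l).value z * (Ω.homCoeff b l j).value z -
      (Ω.homCoeff b i l).value z * (Ω.homCoeff a l j).value z)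

/-- `X` is a (single-valued branch of a) fundamental matrix solution on the set `U`, not necessarily
open: near each point of `U` it is the restriction of a local fundamental solution. -/
def IsFundamentalOn (X : CP m → Matrix (Fin n) (Fin n) ℂ) (U : Set (CP m)) : Prop :=
  ∀ p ∈ U, ∃ Y, Ω.IsFundamentalNear Y p ∧ ∀ᶠ q in 𝓝[U] p, X q = Y q

/-- Regularity: on every simply connected semialgebraic set `U` outside the polar locus `Σ`, every
fundamental solution satisfies `|X| + |X⁻¹| ≤ C dist (·, Σ)⁻ᴺ`. -/
def IsRegular : Prop :=
  ∀ U : Set (CP m), IsSimplyConnected U → CP.IsSemialgebraic U → Disjoint U Ω.polarLocus →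
    ∀ X, Ω.IsFundamentalOn X U →
      ∃ (C : ℝ) (N : ℕ), ∀ p ∈ U, ∀ i j,
        ‖X p i j‖ + ‖(X p)⁻¹ i j‖ ≤ C / CP.distTo p Ω.polarLocus ^ N

/-- `Y` is an analytic continuation of a fundamental solution along the path `γ`: each `Y s` is a
fundamental solution near `γ s`, and the germs fit together. -/
def IsContinuation (γ : unitInterval → CP m)
    (Y : unitInterval → CP m → Matrix (Fin n) (Fin n) ℂ) : Prop :=
  ∀ s, Ω.IsFundamentalNear (Y s) (γ s) ∧ ∀ᶠ s' in 𝓝 s, Y s' =ᶠ[𝓝 (γ s')] Y s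

/-- `M` is a monodromy matrix of the loop `γ`: continuation along `γ` carries some fundamental
solution `X` to `X M`. (A flat system can be continued along every path outside its polar locus, so
every loop there has a monodromy matrix, and it is unique up to conjugation.) -/
def IsMonodromy (γ : unitInterval → CP m) (M : Matrix (Fin n) (Fin n) ℂ) : Prop :=
  ∃ Y, Ω.IsContinuation γ Y ∧ Y 1 =ᶠ[𝓝 (γ 0)] fun p => Y 0 p * M

/-- `γ` is holomorphic near the closed disc of radius `ε`, maps its centre into the polar locus, and
maps no other point of the disc there. -/
structure IsSmallDisc (γ : ℂ → CP m) (ε : ℝ) : Prop where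
  pos : 0 < ε
  holomorphic : ∃ ψ : ℂ → Fin (m + 1) → ℂ, AnalyticOnNhd ℂ ψ (Metric.closedBall 0 ε) ∧
    ∀ z ∈ Metric.closedBall (0 : ℂ) ε, ∃ h : ψ z ≠ 0, γ z = Projectivization.mk ℂ (ψ z) h
  center : γ 0 ∈ Ω.polarLocus
  off : ∀ z ∈ Metric.closedBall (0 : ℂ) ε, z ≠ 0 → γ z ∉ Ω.polarLocus

/-- The image under `γ` of the circle of radius `ε`. -/
def smallLoop (γ : ℂ → CP m) (ε : ℝ) (s : unitInterval) : CP m :=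
  γ (ε * Complex.exp (2 * Real.pi * Complex.I * (s : ℝ)))

/-- Quasiunipotence: all eigenvalues of the monodromy along any small loop around the polar locus
are roots of unity. -/
def IsQuasiunipotent : Prop :=
  ∀ (γ : ℂ → CP m) (ε : ℝ), Ω.IsSmallDisc γ ε →
    ∀ M, Ω.IsMonodromy (smallLoop γ ε) M →
      ∀ μ : ℂ, Module.End.HasEigenvalue (Matrix.toLin' M) μ → ∃ k : ℕ, 0 < k ∧ μ ^ k = 1

/-- A Q-system: a flat regular quasiunipotent Pfaffian system defined over `ℚ`. -/
structure IsQSystem : Prop where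
  flat : Ω.IsFlat
  regular : Ω.IsRegular
  quasiunipotent : Ω.IsQuasiunipotent

end PfaffianSystem

/-! ### Multivalued analytic functions -/

/-- A multivalued analytic function on (a part of) `ℂPᵐ`: a holomorphic function on a connected
space spread over `ℂPᵐ` by a local homeomorphism. A point `e` of the space together with the germ
of the function at `e` is one of the branches over the point `proj e`. -/
structure MultivaluedFunction (m : ℕ) : Type (u + 1) where
  /-- The space of branches. -/
  space : Type u
  [top : TopologicalSpace space]
  [connected : ConnectedSpace space]
  /-- The projection to `ℂPᵐ`. -/
  proj : space → CP m
  isLocalHomeomorph : IsLocalHomeomorph proj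
  /-- The function itself. -/
  toFun : space → ℂ
  holomorphic : ∀ e, ∃ g : CP m → ℂ, CP.HolomorphicAt g (proj e) ∧ toFun =ᶠ[𝓝 e] g ∘ proj

namespace MultivaluedFunction

attribute [instance] MultivaluedFunction.top MultivaluedFunction.connected

variable {m : ℕ} (F : MultivaluedFunction.{u} m)

/-- `F` is an algebraic function defined over `ℚ`: in the affine chart it satisfies an equation
`P(t, y) = 0` with a nonzero polynomial `P ∈ ℚ[t₁, …, tₘ][y]`. -/
def IsAlgebraicOverRat : Prop :=
  ∃ P : Polynomial (MvPolynomial (Fin m) ℚ), P ≠ 0 ∧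
    ∀ (e : F.space) (t : Fin m → ℂ), F.proj e = CP.affine t →
      P.eval₂ (MvPolynomial.aeval t : MvPolynomial (Fin m) ℚ →ₐ[ℚ] ℂ).toRingHom (F.toFun e) = 0

/-- `F` is a Q-function: outside the polar locus of some Q-system, every branch of `F` is one and
the same linear combination `∑ c_ij X_ij` of the components of a branch of a fundamental matrix
solution `X` of the system. -/
def IsQFunction : Prop :=
  ∃ (n : ℕ) (Ω : PfaffianSystem m n), Ω.IsQSystem ∧
    ∃ c : Fin n → Fin n → ℂ, ∀ e : F.space, F.proj e ∉ Ω.polarLocus →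
      ∃ X : CP m → Matrix (Fin n) (Fin n) ℂ, Ω.IsFundamentalNear X (F.proj e) ∧
        ∀ᶠ e' in 𝓝 e, F.toFun e' = ∑ i, ∑ j, c i j * X (F.proj e') i j

end MultivaluedFunction

end

noncomputable section

/-! Let `P(t, y) = 0` be the equation of the algebraic function. Replace `P` by a polynomial `Q(t,
y)`, separable in `y`, whose roots include those of `P` wherever a suitable denominator `D(t)` does
not vanish (`exists_separableEquation`). For a root `y`, implicit differentiation gives `∂y/∂tₖ =
-Q_{tₖ}/Q_y`. The Bézout identity for `Q` and `Q_y` inverts `Q_y`, and reduction modulo `Q` writes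
every `d(yⁱ)` as a combination of `1, y, …, y^(deg Q - 1)` with coefficients in `ℚ(t)`, the same for
all roots (`hasFDerivAt_root_pow`). The Vandermonde matrices of the roots are therefore fundamental
solutions of one Pfaffian system over `ℚ`, and each branch of the function is an entry of such a
matrix.

Off `D = 0` an enumeration of the roots is unique up to permutation, so these matrices form a torsor
under a finite group of constant matrices. By uniqueness of solutions, a solution continued along a
connected set keeps its position relative to the torsor (`eventually_frameClass_eq`). This yields
the axioms of a Q-system. Flatness is symmetry of second derivatives of a local solution. Monodromy
is conjugate to a permutation matrix extended by an identity block, hence of finite order.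
Regularity holds because the roots, and the inverse Vandermonde matrix in Lagrange form, are bounded
by a power of `1 + ‖t‖ + 1/|D(t)|`, which a Łojasiewicz inequality
(`infDist_pow_le_of_isHomogeneous`) turns into a power of the inverse distance.

These estimates refer to the hypersurface `D = 0` together with infinity, while cancellation might
make the polar locus of the root system smaller. So a unipotent block with a rational, hence
single-valued, fundamental matrix is added; its coefficients have poles on all of that set
(`mem_polarLocus`). `IsFrameField` isolates the properties used, and `IsFrameField.isQSystem` draws
the conclusion from them. -/

theorem hasFDerivAt_aeval {k : ℕ} (p : MvPolynomial (Fin k) ℚ) (z : Fin k → ℂ) :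
    HasFDerivAt (fun w : Fin k → ℂ => MvPolynomial.aeval w p)
      (∑ a, MvPolynomial.aeval z (MvPolynomial.pderiv a p) •
        ContinuousLinearMap.proj (R := ℂ) (φ := fun _ : Fin k => ℂ) a) z := by
  induction p using MvPolynomial.induction_on with
  | C c =>
    simp only [MvPolynomial.aeval_C]
    exact (hasFDerivAt_const (𝕜 := ℂ) (algebraMap ℚ ℂ c) z).congr_fderiv (by ext; simp)
  | add p q hp hq =>
    simp only [map_add]
    refine (hp.fun_add hq).congr_fderiv ?_
    simp only [← Finset.sum_add_distrib, ← add_smul]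
  | mul_X p a hp =>
    simp only [map_mul, MvPolynomial.aeval_X]
    refine (hp.fun_mul (hasFDerivAt_apply a z)).congr_fderiv ?_
    ext v
    simp [Derivation.leibniz, MvPolynomial.pderiv_X, Pi.single_apply, add_mul,
      Finset.sum_add_distrib, Finset.mul_sum, apply_ite (MvPolynomial.aeval z), mul_assoc]

/-! ### Values of rational functions, computed from unreduced fractions -/

namespace RatFun

variable {k : ℕ}

/-- The rational function `r` is represented near `z` by a fraction with nonvanishing denominator,
and `v` is the value of that fraction at `z`. -/
def HasValue (r : RatFun k) (z : Fin k → ℂ) (v : ℂ) : Prop :=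
  ∃ a b : MvPolynomial (Fin k) ℚ,
    r * algebraMap _ (RatFun k) b = algebraMap _ (RatFun k) a ∧
      MvPolynomial.aeval z b ≠ 0 ∧ v * MvPolynomial.aeval z b = MvPolynomial.aeval z a

theorem mul_den (r : RatFun k) :
    r * algebraMap _ (RatFun k) r.den = algebraMap _ (RatFun k) r.num := by
  have h : algebraMap (MvPolynomial (Fin k) ℚ) (RatFun k) r.den ≠ 0 :=
    IsFractionRing.to_map_ne_zero_of_mem_nonZeroDivisors
      (IsFractionRing.den (MvPolynomial (Fin k) ℚ) r).2
  rw [← eq_div_iff h]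
  exact (IsFractionRing.mk'_num_den' (MvPolynomial (Fin k) ℚ) r).symm

theorem num_mul_eq {r : RatFun k} {a b : MvPolynomial (Fin k) ℚ}
    (h : r * algebraMap _ (RatFun k) b = algebraMap _ (RatFun k) a) :
    r.num * b = a * r.den := by
  apply IsFractionRing.injective (MvPolynomial (Fin k) ℚ) (RatFun k)
  rw [map_mul, map_mul, ← h, ← mul_den]
  ring

/-- Reduced numerator and denominator are coprime, and `num * b = a * den`. Hence regularity can be
checked on any fraction whose denominator survives at the point. -/
theorem den_dvd {r : RatFun k} {a b : MvPolynomial (Fin k) ℚ}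
    (h : r * algebraMap _ (RatFun k) b = algebraMap _ (RatFun k) a) : r.den ∣ b := by
  have h1 : r.den ∣ r.num * b := ⟨a, by rw [num_mul_eq h, mul_comm]⟩
  exact (IsFractionRing.num_den_reduced (MvPolynomial (Fin k) ℚ) r).symm.dvd_of_dvd_mul_left h1

theorem HasValue.regularAt {r : RatFun k} {z : Fin k → ℂ} {v : ℂ} (h : r.HasValue z v) :
    r.RegularAt z := by
  obtain ⟨a, b, hab, hb, -⟩ := h
  obtain ⟨c, rfl⟩ := den_dvd hab
  rw [map_mul] at hb
  exact left_ne_zero_of_mul hb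

theorem HasValue.value_eq {r : RatFun k} {z : Fin k → ℂ} {v : ℂ} (h : r.HasValue z v) :
    r.value z = v := by
  have h0 : MvPolynomial.aeval z r.den ≠ 0 := h.regularAt
  obtain ⟨a, b, hab, hb, hv⟩ := h
  rw [value, div_eq_iff h0]
  apply mul_right_cancel₀ hb
  have := congrArg (MvPolynomial.aeval z) (num_mul_eq hab)
  rw [map_mul, map_mul, ← hv] at this
  rw [this]
  ring

theorem RegularAt.hasValue {r : RatFun k} {z : Fin k → ℂ} (h : r.RegularAt z) :
    r.HasValue z (r.value z) :=
  ⟨r.num, r.den, mul_den r, h, div_mul_cancel₀ _ h⟩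

theorem hasValue_algebraMap (p : MvPolynomial (Fin k) ℚ) (z : Fin k → ℂ) :
    (algebraMap _ (RatFun k) p).HasValue z (MvPolynomial.aeval z p) :=
  ⟨p, 1, by simp, by simp, by simp⟩

theorem hasValue_coord (a : Fin k) (z : Fin k → ℂ) : (coord a).HasValue z (z a) := by
  have := hasValue_algebraMap (MvPolynomial.X a) z
  rwa [MvPolynomial.aeval_X] at this

theorem hasValue_zero (z : Fin k → ℂ) : (0 : RatFun k).HasValue z 0 := by
  simpa using hasValue_algebraMap (k := k) 0 z

variable {r s : RatFun k} {z : Fin k → ℂ} {v w : ℂ}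

theorem HasValue.add (hr : r.HasValue z v) (hs : s.HasValue z w) :
    (r + s).HasValue z (v + w) := by
  obtain ⟨a, b, h, hb, hv⟩ := hr
  obtain ⟨a', b', h', hb', hv'⟩ := hs
  refine ⟨a * b' + a' * b, b * b', ?_, by simpa using ⟨hb, hb'⟩, ?_⟩
  · simp only [map_add, map_mul, ← h, ← h']
    ring
  · simp only [map_add, map_mul, ← hv, ← hv']
    ring

theorem HasValue.mul (hr : r.HasValue z v) (hs : s.HasValue z w) :
    (r * s).HasValue z (v * w) := by
  obtain ⟨a, b, h, hb, hv⟩ := hr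
  obtain ⟨a', b', h', hb', hv'⟩ := hs
  refine ⟨a * a', b * b', ?_, by simpa using ⟨hb, hb'⟩, ?_⟩
  · simp only [map_mul, ← h, ← h']
    ring
  · simp only [map_mul, ← hv, ← hv']
    ring

theorem HasValue.neg (hr : r.HasValue z v) : (-r).HasValue z (-v) := by
  obtain ⟨a, b, h, hb, hv⟩ := hr
  exact ⟨-a, b, by simp [← h], hb, by simp [← hv]⟩

theorem HasValue.sum {ι : Type*} (S : Finset ι) {r : ι → RatFun k} {v : ι → ℂ}
    (h : ∀ i ∈ S, (r i).HasValue z (v i)) : (∑ i ∈ S, r i).HasValue z (∑ i ∈ S, v i) := by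
  classical
  induction S using Finset.induction_on with
  | empty => simpa using hasValue_zero z
  | insert a S ha ih =>
    rw [Finset.sum_insert ha, Finset.sum_insert ha]
    exact (h a (by simp)).add (ih fun i hi => h i (Finset.mem_insert_of_mem hi))

theorem HasValue.inv (hr : r.HasValue z v) (hv0 : v ≠ 0) : (r⁻¹).HasValue z v⁻¹ := by
  obtain ⟨a, b, h, hb, hv⟩ := hr
  have ha : MvPolynomial.aeval z a ≠ 0 := by
    rw [← hv]
    exact mul_ne_zero hv0 hb
  have hr0 : r ≠ 0 := by
    rintro rfl
    apply ha
    have : a = 0 := IsFractionRing.injective (MvPolynomial (Fin k) ℚ) (RatFun k)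
      (by rw [← h, zero_mul, map_zero])
    rw [this, map_zero]
  exact ⟨b, a, by rw [← h, inv_mul_cancel_left₀ hr0], ha, by rw [← hv, inv_mul_cancel_left₀ hv0]⟩

theorem HasValue.div (hr : r.HasValue z v) (hs : s.HasValue z w) (hw : w ≠ 0) :
    (r / s).HasValue z (v / w) := by
  rw [div_eq_mul_inv, div_eq_mul_inv]
  exact hr.mul (hs.inv hw)

theorem HasValue.pow (hr : r.HasValue z v) (n : ℕ) : (r ^ n).HasValue z (v ^ n) := by
  induction n with
  | zero => simpa using hasValue_algebraMap (k := k) 1 z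
  | succ n ih =>
    rw [pow_succ, pow_succ]
    exact ih.mul hr

/-- If a product with a polynomial vanishing at `z` is a polynomial which does not vanish at `z`,
the rational function has a pole at `z`. -/
theorem not_regularAt_of_mul_eq {a b : MvPolynomial (Fin k) ℚ}
    (h : r * algebraMap _ (RatFun k) b = algebraMap _ (RatFun k) a)
    (hb : MvPolynomial.aeval z b = 0) (ha : MvPolynomial.aeval z a ≠ 0) : ¬ r.RegularAt z := by
  intro hreg
  have := congrArg (MvPolynomial.aeval z) (num_mul_eq h)
  rw [map_mul, map_mul, hb, mul_zero] at this
  exact mul_ne_zero ha hreg this.symm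

theorem hasValue_homogenizePoly {m : ℕ} (p : MvPolynomial (Fin m) ℚ) {z : Fin (m + 1) → ℂ}
    (hz : z 0 ≠ 0) : (homogenizePoly m p).HasValue z
      (MvPolynomial.aeval (fun k => z k.succ / z 0) p) := by
  induction p using MvPolynomial.induction_on with
  | C c =>
    have := hasValue_algebraMap (MvPolynomial.C c : MvPolynomial (Fin (m + 1)) ℚ) z
    simp only [homogenizePoly, MvPolynomial.aeval_C] at this ⊢
    rwa [← MvPolynomial.algebraMap_eq, ← IsScalarTower.algebraMap_apply] at this
  | add p q hp hq =>
    rw [map_add, map_add]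
    exact hp.add hq
  | mul_X p k hp =>
    rw [map_mul, map_mul]
    refine hp.mul ?_
    simp only [homogenizePoly, MvPolynomial.aeval_X]
    exact (hasValue_coord _ _).div (hasValue_coord _ _) hz

theorem homogenize_algebraMap {m : ℕ} (p : MvPolynomial (Fin m) ℚ) :
    homogenize m (algebraMap _ (RatFun m) p) = homogenizePoly m p := by
  simp only [homogenize]
  exact IsLocalization.lift_eq _ p

theorem HasValue.homogenize {m : ℕ} {r : RatFun m} {z : Fin (m + 1) → ℂ} {v : ℂ}
    (h : r.HasValue (fun k => z k.succ / z 0) v) (hz : z 0 ≠ 0) :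
    (homogenize m r).HasValue z v := by
  obtain ⟨a, b, hab, hb, hv⟩ := h
  have hB := hasValue_homogenizePoly b hz
  have hA := hasValue_homogenizePoly a hz
  have h0 : homogenizePoly m b ≠ 0 := by
    rw [Ne, map_eq_zero_iff _ (homogenizePoly_injective m)]
    rintro rfl
    simp at hb
  have key : _root_.homogenize m r = homogenizePoly m a / homogenizePoly m b := by
    rw [eq_div_iff h0, ← homogenize_algebraMap, ← homogenize_algebraMap, ← map_mul, hab]
  rw [key, eq_div_of_mul_eq hb hv]
  exact hA.div hB hb

theorem RegularAt.differentiableAt (h : r.RegularAt z) : DifferentiableAt ℂ r.value z := by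
  have h1 := (hasFDerivAt_aeval r.num z).differentiableAt
  have h2 := (hasFDerivAt_aeval r.den z).differentiableAt
  have h3 := h1.fun_mul ((differentiableAt_inv h).comp z h2)
  have e : r.value = fun w => MvPolynomial.aeval w r.num * (MvPolynomial.aeval w r.den)⁻¹ :=
    funext fun w => div_eq_mul_inv _ _
  rw [e]
  exact h3

end RatFun

/-! ### The affine chart of projective space -/

namespace CP

variable {m : ℕ}

/-- The affine coordinates `z_k / z₀` of a point (with junk values at infinity). -/
def coords (p : CP m) (k : Fin m) : ℂ := p.rep k.succ / p.rep 0

theorem coords_mk (z : Fin (m + 1) → ℂ) (hz : z ≠ 0) :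
    coords (Projectivization.mk ℂ z hz) = fun k => z k.succ / z 0 := by
  obtain ⟨a, ha⟩ := Projectivization.exists_smul_eq_mk_rep ℂ z hz
  funext k
  simp only [coords, ← ha, Units.smul_def, Pi.smul_apply, smul_eq_mul]
  exact mul_div_mul_left _ _ a.ne_zero

theorem coords_affine (t : Fin m → ℂ) : coords (affine t) = t := by
  simp [affine, coords_mk]

theorem affine_div {z : Fin (m + 1) → ℂ} (hz : z ≠ 0) (h0 : z 0 ≠ 0) :
    affine (fun k => z k.succ / z 0) = Projectivization.mk ℂ z hz := by
  rw [affine, Projectivization.mk_eq_mk_iff']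
  refine ⟨(z 0)⁻¹, ?_⟩
  funext a
  refine Fin.cases ?_ (fun k => ?_) a
  · simp [h0]
  · simp [div_eq_inv_mul]

theorem continuous_mk : Continuous
    fun v : {v : Fin (m + 1) → ℂ // v ≠ 0} => Projectivization.mk ℂ v.1 v.2 :=
  continuous_coinduced_rng

theorem cons_one_ne_zero (t : Fin m → ℂ) : (Fin.cons 1 t : Fin (m + 1) → ℂ) ≠ 0 := fun h => by
  simpa using congrFun h 0

theorem continuous_cons_one : Continuous fun t : Fin m → ℂ => (Fin.cons 1 t : Fin (m + 1) → ℂ) :=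
  continuous_pi fun a => Fin.cases (by simpa using continuous_const)
    (fun k => by simpa using continuous_apply k) a

theorem continuous_affine : Continuous (affine : (Fin m → ℂ) → CP m) :=
  continuous_mk.comp (continuous_cons_one.subtype_mk cons_one_ne_zero)

/-- In the quotient topology openness is tested on the preimage in the punctured cone, which is cut
out by `z₀ ≠ 0` and `z / z₀ ∈ O`. This lets neighbourhoods of affine points be described in the
coordinates `t`. -/
theorem isOpenMap_affine : IsOpenMap (affine : (Fin m → ℂ) → CP m) := by
  intro O hO
  rw [isOpen_coinduced]
  have : (fun v : {v : Fin (m + 1) → ℂ // v ≠ 0} => Projectivization.mk ℂ v.1 v.2) ⁻¹'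
      (affine '' O) = {v | v.1 0 ≠ 0} ∩ {v | (fun k : Fin m => v.1 k.succ / v.1 0) ∈ O} := by
    ext v
    constructor
    · rintro ⟨t, ht, h⟩
      have h' := h
      rw [affine, Projectivization.mk_eq_mk_iff] at h
      obtain ⟨a, ha⟩ := h
      have h0 : v.1 0 ≠ 0 := by
        intro h0
        simpa [h0] using congrFun ha 0
      refine ⟨h0, ?_⟩
      have := congrArg coords h'
      rw [coords_affine, coords_mk] at this
      simpa only [Set.mem_ofPred_eq, ← this] using ht
    · rintro ⟨h0, h⟩
      exact ⟨_, h, affine_div v.2 h0⟩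
  rw [this]
  have hc : ∀ a, Continuous fun v : {v : Fin (m + 1) → ℂ // v ≠ 0} => v.1 a := fun a =>
    (continuous_apply a).comp continuous_subtype_val
  refine ContinuousOn.isOpen_inter_preimage (t := O) ?_ (isOpen_ne_fun (hc 0) continuous_const) hO
  exact continuousOn_pi.2 fun k => (hc k.succ).continuousOn.div (hc 0).continuousOn fun v hv => hv

theorem map_affine_nhds (t : Fin m → ℂ) : Filter.map affine (𝓝 t) = 𝓝 (affine t) :=
  le_antisymm continuous_affine.continuousAt (isOpenMap_affine.nhds_le t)

theorem eventually_nhds_affine {t : Fin m → ℂ} {Q : CP m → Prop} :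
    (∀ᶠ q in 𝓝 (affine t), Q q) ↔ ∀ᶠ t' in 𝓝 t, Q (affine t') := by
  rw [← map_affine_nhds, Filter.eventually_map]

theorem pullback_apply {E : Type*} [Zero E] (f : CP m → E) {z : Fin (m + 1) → ℂ} (hz : z ≠ 0) :
    pullback f z = f (Projectivization.mk ℂ z hz) := by
  simp [pullback, hz]

end CP

/-! ### Solutions in affine and in homogeneous coordinates -/

namespace PfaffianSystem

variable {m n : ℕ} (Ω : PfaffianSystem m n)

/-- The matrix function `X` of the affine coordinates satisfies `dX = Ω X` at the point `t`. -/
def AffineSolvesAt (X : (Fin m → ℂ) → Matrix (Fin n) (Fin n) ℂ) (t : Fin m → ℂ) : Prop :=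
  ∀ i j, HasFDerivAt (fun t' => X t' i j)
    (∑ k, (∑ l, (Ω.coeff k i l).value t * X t l j) •
      ContinuousLinearMap.proj (R := ℂ) (φ := fun _ : Fin m => ℂ) k) t

variable {Ω}

theorem hasValue_homCoeff_succ {z : Fin (m + 1) → ℂ} (hz : z 0 ≠ 0) (k : Fin m) (i j : Fin n)
    (h : (Ω.coeff k i j).RegularAt fun k => z k.succ / z 0) :
    (Ω.homCoeff k.succ i j).HasValue z
      ((Ω.coeff k i j).value (fun k => z k.succ / z 0) / z 0) :=
  (h.hasValue.homogenize hz).div (RatFun.hasValue_coord _ _) hz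

theorem hasValue_homCoeff_zero {z : Fin (m + 1) → ℂ} (hz : z 0 ≠ 0) (i j : Fin n)
    (h : ∀ k, (Ω.coeff k i j).RegularAt fun k => z k.succ / z 0) :
    (Ω.homCoeff 0 i j).HasValue z
      (-∑ k : Fin m, z k.succ / z 0 ^ 2 * (Ω.coeff k i j).value (fun k => z k.succ / z 0)) :=
  (RatFun.HasValue.sum _ fun k _ => ((RatFun.hasValue_coord _ _).div
    ((RatFun.hasValue_coord _ _).pow 2) (pow_ne_zero 2 hz)).mul ((h k).hasValue.homogenize hz)).neg

/-- Chain rule along `t ↦ (1, t)`: `z₀` is constant there, so the coefficient of `dz₀` drops out and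
the others reduce to `Aₖ(t)`. -/
theorem SolvesAt.affineSolvesAt {X : CP m → Matrix (Fin n) (Fin n) ℂ} {t : Fin m → ℂ}
    (hreg : ∀ k i j, (Ω.coeff k i j).RegularAt t) (h : Ω.SolvesAt X (CP.affine t)) :
    Ω.AffineSolvesAt (fun t' => X (CP.affine t')) t := by
  intro i j
  have h1 := h (Fin.cons 1 t) (CP.cons_one_ne_zero t) rfl i j
  have h2 : HasFDerivAt (fun t : Fin m → ℂ => (Fin.cons 1 t : Fin (m + 1) → ℂ))
      (ContinuousLinearMap.pi (Fin.cons 0 fun k =>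
        ContinuousLinearMap.proj (R := ℂ) (φ := fun _ : Fin m => ℂ) k)) t := by
    rw [hasFDerivAt_pi]
    intro a
    refine Fin.cases ?_ (fun k => ?_) a
    · simpa using hasFDerivAt_const _ _
    · simpa using hasFDerivAt_apply k t
  have h3 := h1.comp t h2
  have e : (CP.pullback fun q => X q i j) ∘ (fun t : Fin m → ℂ => (Fin.cons 1 t : Fin (m + 1) → ℂ))
      = fun t' => X (CP.affine t') i j := by
    funext t'
    exact CP.pullback_apply _ (CP.cons_one_ne_zero t')
  rw [e] at h3
  refine h3.congr_fderiv ?_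
  ext v
  have hc : ∀ k l,
      (Ω.homCoeff (Fin.succ k) i l).value (Fin.cons 1 t) = (Ω.coeff k i l).value t := by
    intro k l
    have := (hasValue_homCoeff_succ (Ω := Ω) (z := Fin.cons 1 t) (by simp) k i l
      (by simpa using hreg k i l)).value_eq
    simpa using this
  simp [Fin.sum_univ_succ, hc]

/-- Chain rule along `z ↦ z / z₀`: the `dz₀` terms of the quotient rule add up to `homCoeff 0`. -/
theorem AffineSolvesAt.solvesAt {X : (Fin m → ℂ) → Matrix (Fin n) (Fin n) ℂ} {t : Fin m → ℂ}
    (hreg : ∀ k i j, (Ω.coeff k i j).RegularAt t) (h : Ω.AffineSolvesAt X t) :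
    Ω.SolvesAt (fun p => X (CP.coords p)) (CP.affine t) := by
  intro z hz hzt i j
  have ht : (fun k : Fin m => z k.succ / z 0) = t := by
    rw [← CP.coords_mk z hz, hzt, CP.coords_affine]
  have h0 : z 0 ≠ 0 := by
    rw [CP.affine, Projectivization.mk_eq_mk_iff'] at hzt
    obtain ⟨a, ha⟩ := hzt
    rw [← ha]
    rintro h
    apply hz
    have : a = 0 := by simpa using h
    rw [← ha, this, zero_smul]
  have h2 : ∀ k : Fin m, HasFDerivAt (fun w : Fin (m + 1) → ℂ => w k.succ / w 0)
      ((z 0)⁻¹ • ContinuousLinearMap.proj (R := ℂ) (φ := fun _ : Fin (m + 1) => ℂ) k.succ -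
        (z k.succ / z 0 ^ 2) •
          ContinuousLinearMap.proj (R := ℂ) (φ := fun _ : Fin (m + 1) => ℂ) 0) z := by
    intro k
    simp only [div_eq_mul_inv]
    refine ((hasFDerivAt_apply k.succ z).fun_mul
      ((hasDerivAt_inv h0).comp_hasFDerivAt z (hasFDerivAt_apply 0 z))).congr_fderiv ?_
    ext v
    simp
    ring
  have h3 := h i j
  rw [← ht] at h3
  have h4 := h3.comp z (hasFDerivAt_pi.2 h2)
  have e : (CP.pullback fun p => X (CP.coords p) i j) =ᶠ[𝓝 z]
      (fun t' => X t' i j) ∘ fun w k => w (Fin.succ k) / w 0 := by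
    filter_upwards [isOpen_ne.mem_nhds hz] with w hw
    rw [CP.pullback_apply _ hw, CP.coords_mk]
    rfl
  refine (h4.congr_of_eventuallyEq e).congr_fderiv ?_
  simp only [CP.coords_affine, ← ht]
  ext v
  have hs : ∀ k l, (Ω.homCoeff (Fin.succ k) i l).value z = _ := fun k l =>
    (hasValue_homCoeff_succ h0 k i l (by rw [ht]; exact hreg k i l)).value_eq
  have hz' : ∀ l, (Ω.homCoeff 0 i l).value z = _ := fun l =>
    (hasValue_homCoeff_zero h0 i l (by rw [ht]; exact fun k => hreg k i l)).value_eq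
  simp only [Fin.sum_univ_succ, hs, hz']
  simp [Finset.sum_mul, mul_sub, Finset.sum_sub_distrib, neg_mul]
  rw [neg_add_eq_sub]
  congr 1
  · exact Finset.sum_congr rfl fun _ _ => Finset.sum_congr rfl fun _ _ => by ring
  · rw [Finset.sum_comm]
    exact Finset.sum_congr rfl fun _ _ => Finset.sum_congr rfl fun _ _ => by ring

end PfaffianSystem

/-! ### Homogeneous polynomials and the distance to a hypersurface -/

theorem exists_homogenization {m : ℕ} (D : MvPolynomial (Fin m) ℚ) :
    ∃ (e : ℕ) (G : MvPolynomial (Fin (m + 1)) ℚ), G.IsHomogeneous e ∧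
      algebraMap _ (RatFun (m + 1)) G = RatFun.coord 0 ^ e * homogenizePoly m D := by
  have h0 : (RatFun.coord 0 : RatFun (m + 1)) ≠ 0 := fun h =>
    MvPolynomial.X_ne_zero (R := ℚ) (0 : Fin (m + 1))
      (IsFractionRing.injective (MvPolynomial (Fin (m + 1)) ℚ) (RatFun (m + 1))
        (h.trans (map_zero _).symm))
  obtain ⟨e, he⟩ : ∃ e, e = D.totalDegree := ⟨_, rfl⟩
  refine ⟨e, ∑ s ∈ D.support, MvPolynomial.C (D.coeff s) *
    (MvPolynomial.X 0 ^ (e - ∑ k, s k) * ∏ k, MvPolynomial.X (Fin.succ k) ^ s k),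
    ?_, ?_⟩
  · refine MvPolynomial.IsHomogeneous.sum _ _ _ fun s hs => ?_
    have hle : ∑ k, s k ≤ e := by
      have := MvPolynomial.le_totalDegree hs
      rwa [Finsupp.sum_fintype _ _ (fun _ => rfl), ← he] at this
    have h1 := MvPolynomial.IsHomogeneous.prod (R := ℚ) Finset.univ
      (fun k : Fin m => MvPolynomial.X (Fin.succ k) ^ s k) (fun k => s k)
      fun k _ => by simpa using (MvPolynomial.isHomogeneous_X ℚ (Fin.succ k)).pow (s k)
    have h2 := (MvPolynomial.isHomogeneous_X ℚ (0 : Fin (m + 1))).pow (e - ∑ k, s k)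
    have h3 := (MvPolynomial.isHomogeneous_C (Fin (m + 1)) (D.coeff s)).mul (h2.mul h1)
    convert h3 using 1
    omega
  · conv_rhs => rw [D.as_sum]
    rw [map_sum, map_sum, Finset.mul_sum]
    refine Finset.sum_congr rfl fun s hs => ?_
    have hle : ∑ k, s k ≤ e := by
      have := MvPolynomial.le_totalDegree hs
      rwa [Finsupp.sum_fintype _ _ (fun _ => rfl), ← he] at this
    have hC : algebraMap (MvPolynomial (Fin (m + 1)) ℚ) (RatFun (m + 1))
        (MvPolynomial.C (D.coeff s)) = algebraMap ℚ _ (D.coeff s) := by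
      rw [← MvPolynomial.algebraMap_eq, ← IsScalarTower.algebraMap_apply]
    rw [homogenizePoly, MvPolynomial.aeval_monomial, Finsupp.prod_fintype _ _ (fun _ => pow_zero _)]
    simp only [map_mul, map_prod, map_pow, hC]
    change _ * (RatFun.coord 0 ^ _ * ∏ k, RatFun.coord (Fin.succ k) ^ s k) = _
    simp only [div_pow, Finset.prod_div_distrib, Finset.prod_pow_eq_pow_sum]
    rw [mul_left_comm (RatFun.coord 0 ^ e)]
    congr 1
    rw [← mul_div_assoc, eq_div_iff (pow_ne_zero _ h0), mul_right_comm, ← pow_add,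
      Nat.sub_add_cancel hle]

theorem norm_aeval_le_of_isHomogeneous {σ : Type*} [Fintype σ] {G : MvPolynomial σ ℚ} {e : ℕ}
    (hG : G.IsHomogeneous e) :
    ∃ K : ℝ, 0 ≤ K ∧ ∀ z : σ → ℂ, ‖MvPolynomial.aeval z G‖ ≤ K * ‖z‖ ^ e := by
  refine ⟨∑ s ∈ G.support, ‖(algebraMap ℚ ℂ) (G.coeff s)‖,
    Finset.sum_nonneg fun _ _ => norm_nonneg _, fun z => ?_⟩
  rw [MvPolynomial.aeval_def, MvPolynomial.eval₂_eq', Finset.sum_mul]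
  refine (norm_sum_le _ _).trans (Finset.sum_le_sum fun s hs => ?_)
  rw [norm_mul, norm_prod]
  refine mul_le_mul_of_nonneg_left ?_ (norm_nonneg _)
  have hs' : ∑ k, s k = e := by
    have := hG (MvPolynomial.mem_support_iff.1 hs)
    simpa [Finsupp.weight_apply, Finsupp.sum_fintype] using this
  rw [← hs', ← Finset.prod_pow_eq_pow_sum]
  refine Finset.prod_le_prod (fun _ _ => norm_nonneg _) fun k _ => ?_
  rw [norm_pow]
  exact pow_le_pow_left₀ (norm_nonneg _) (norm_le_pi_norm z k) _

/-- On the line through `z` in the direction `v`, a homogeneous polynomial of degree `N` restricts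
to a polynomial with leading coefficient `H(v)`. -/
theorem exists_restriction_to_line {σ : Type*} [Fintype σ] {H : MvPolynomial σ ℚ} {N : ℕ}
    (hH : H.IsHomogeneous N) (z v : σ → ℂ) :
    ∃ q : Polynomial ℂ, q.natDegree ≤ N ∧ q.coeff N = MvPolynomial.aeval v H ∧
      ∀ x : ℂ, q.eval x = MvPolynomial.aeval (z + x • v) H := by
  have hlin : ∀ a, (Polynomial.C (v a) * Polynomial.X + Polynomial.C (z a)).natDegree ≤ 1 :=
    fun a => Polynomial.natDegree_linear_le
  have hdeg : ∀ s ∈ H.support, ∑ k, s k = N := fun s hs => by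
    have := hH (MvPolynomial.mem_support_iff.1 hs)
    simpa [Finsupp.weight_apply, Finsupp.sum_fintype] using this
  have hpow : ∀ (s : σ →₀ ℕ) (a : σ),
      ((Polynomial.C (v a) * Polynomial.X + Polynomial.C (z a)) ^ s a).natDegree ≤ s a :=
    fun s a => (Polynomial.natDegree_pow_le_of_le _ (hlin a)).trans_eq (mul_one _)
  have hprod : ∀ s : σ →₀ ℕ,
      (∏ a, (Polynomial.C (v a) * Polynomial.X + Polynomial.C (z a)) ^ s a).natDegree ≤ ∑ a, s a :=
    fun s => (Polynomial.natDegree_prod_le _ _).trans (Finset.sum_le_sum fun a _ => hpow s a)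
  -- Top coefficients multiply: the factor `v a * X + z a` contributes `v a` in degree one, even if
  -- `v a = 0`.
  have hcoeff : ∀ (S : Finset σ) (s : σ →₀ ℕ),
      (∏ a ∈ S, (Polynomial.C (v a) * Polynomial.X + Polynomial.C (z a)) ^ s a).coeff
        (∑ a ∈ S, s a) = ∏ a ∈ S, v a ^ s a := by
    classical
    intro S s
    induction S using Finset.induction_on with
    | empty => simp
    | insert a S ha ih =>
      rw [Finset.prod_insert ha, Finset.sum_insert ha, Finset.prod_insert ha,
        Polynomial.coeff_mul_add_eq_of_natDegree_le (hpow s a)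
          ((Polynomial.natDegree_prod_le _ _).trans (Finset.sum_le_sum fun a _ => hpow s a)), ih]
      congr 1
      have := Polynomial.coeff_pow_of_natDegree_le (m := s a) (hlin a)
      simpa using this
  refine ⟨∑ s ∈ H.support, Polynomial.C (algebraMap ℚ ℂ (H.coeff s)) *
    ∏ a, (Polynomial.C (v a) * Polynomial.X + Polynomial.C (z a)) ^ s a, ?_, ?_, ?_⟩
  · refine Polynomial.natDegree_sum_le_of_forall_le _ _ fun s hs => ?_
    exact (Polynomial.natDegree_C_mul_le _ _).trans ((hprod s).trans_eq (hdeg s hs))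
  · rw [Polynomial.finsetSum_coeff, MvPolynomial.aeval_def, MvPolynomial.eval₂_eq']
    refine Finset.sum_congr rfl fun s hs => ?_
    rw [Polynomial.coeff_C_mul, ← hdeg s hs, hcoeff]
  · intro x
    rw [Polynomial.eval_finsetSum, MvPolynomial.aeval_def, MvPolynomial.eval₂_eq']
    refine Finset.sum_congr rfl fun s hs => ?_
    rw [Polynomial.eval_mul, Polynomial.eval_C, Polynomial.eval_prod]
    congr 1
    refine Finset.prod_congr rfl fun a _ => ?_
    simp
    ring

/-- A Łojasiewicz inequality for complex hypersurfaces. -/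
theorem infDist_pow_le_of_isHomogeneous {σ : Type*} [Fintype σ] {H : MvPolynomial σ ℚ} {N : ℕ}
    (hH : H.IsHomogeneous N) (h0 : H ≠ 0) :
    ∃ K : ℝ, 0 ≤ K ∧ ∀ z : σ → ℂ,
      Metric.infDist z {w | MvPolynomial.aeval w H = 0} ^ N ≤ K * ‖MvPolynomial.aeval z H‖ := by
  obtain ⟨v₀, hv₀⟩ : ∃ v : σ → ℚ, MvPolynomial.eval v H ≠ 0 := by
    by_contra! h
    exact h0 (MvPolynomial.funext fun v => by simp [h v])
  -- A direction with `H(v) ≠ 0` makes the restriction to each line `z + x v` have degree exactly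
  -- `N`, with the same leading coefficient for all `z`. This uniformity gives a constant
  -- independent of `z`.
  obtain ⟨v, hv⟩ : ∃ v : σ → ℂ, MvPolynomial.aeval v H ≠ 0 := by
    refine ⟨fun a => algebraMap ℚ ℂ (v₀ a), ?_⟩
    have := MvPolynomial.aeval_algebraMap_apply ℂ v₀ H
    simp only [Function.comp_def] at this
    rw [this]
    simpa using hv₀
  refine ⟨‖v‖ ^ N / ‖MvPolynomial.aeval v H‖, by positivity, fun z => ?_⟩
  obtain ⟨q, hdeg, hlead, heval⟩ := exists_restriction_to_line hH z v
  have hnat : q.natDegree = N := le_antisymm hdeg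
    (Polynomial.le_natDegree_of_ne_zero (by rwa [hlead]))
  have hq0 : q ≠ 0 := by
    rintro rfl
    exact hv (by rw [← hlead, Polynomial.coeff_zero])
  have hsplit := IsAlgClosed.splits q
  have hcard : q.roots.card = N := by rw [← hnat, ← hsplit.natDegree_eq_card_roots]
  have hev : MvPolynomial.aeval z H =
      MvPolynomial.aeval v H * (q.roots.map fun x => -x).prod := by
    have h1 := hsplit.eq_prod_roots
    have h2 := heval 0
    rw [zero_smul, add_zero] at h2
    rw [← h2]
    conv_lhs => rw [h1, Polynomial.leadingCoeff, hnat, hlead]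
    rw [Polynomial.eval_mul, Polynomial.eval_C, Polynomial.eval_multiset_prod, Multiset.map_map]
    simp
  -- A root `x` gives the zero `z + x v` of `H`, at distance `‖v‖ ‖x‖` from `z`. Multiplying over
  -- the `N` roots compares the `N`-th power of the distance with `|H(z) / H(v)|`.
  have hroot : ∀ x ∈ q.roots, Metric.infDist z {w | MvPolynomial.aeval w H = 0} ≤ ‖v‖ * ‖x‖ := by
    intro x hx
    have hx' : MvPolynomial.aeval (z + x • v) H = 0 := by
      rw [← heval]
      exact Polynomial.isRoot_of_mem_roots hx
    refine (Metric.infDist_le_dist_of_mem (s := {w | MvPolynomial.aeval w H = 0}) hx').trans_eq ?_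
    rw [dist_self_add_right, norm_smul, mul_comm]
  have hprod : ∀ S : Multiset ℂ,
      (∀ x ∈ S, Metric.infDist z {w | MvPolynomial.aeval w H = 0} ≤ ‖v‖ * ‖x‖) →
      Metric.infDist z {w | MvPolynomial.aeval w H = 0} ^ S.card ≤
        ‖v‖ ^ S.card * ‖(S.map fun x => -x).prod‖ := by
    intro S
    induction S using Multiset.induction_on with
    | empty => simp
    | cons x S ih =>
      intro h
      have h1 := h x (Multiset.mem_cons_self x S)
      have h2 := ih fun y hy => h y (Multiset.mem_cons_of_mem hy)
      rw [Multiset.card_cons, Multiset.map_cons, Multiset.prod_cons, norm_mul, norm_neg,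
        pow_succ, pow_succ]
      calc _ ≤ (‖v‖ ^ S.card * ‖(S.map fun x => -x).prod‖) * (‖v‖ * ‖x‖) :=
            mul_le_mul h2 h1 Metric.infDist_nonneg (by positivity)
        _ = _ := by ring
  have := hprod q.roots hroot
  rw [hcard] at this
  refine this.trans_eq ?_
  rw [hev, norm_mul]
  field_simp

/-! ### The growth scale against the distance to the hypersurface -/

namespace CP

variable {m : ℕ}

/-- The cone over the union of the hyperplane at infinity and the hypersurface `D = 0`. -/
def zeroCone (D : MvPolynomial (Fin m) ℚ) : Set (Fin (m + 1) → ℂ) :=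
  {z | z 0 = 0 ∨ MvPolynomial.aeval (fun k => z k.succ / z 0) D = 0}

/-- The growth scale of functions with poles along `D = 0` and at infinity. -/
def growth (D : MvPolynomial (Fin m) ℚ) (t : Fin m → ℂ) : ℝ :=
  1 + ‖t‖ + ‖MvPolynomial.aeval t D‖⁻¹

theorem one_le_growth (D : MvPolynomial (Fin m) ℚ) (t : Fin m → ℂ) : 1 ≤ growth D t := by
  unfold growth
  have : 0 ≤ ‖MvPolynomial.aeval t D‖⁻¹ := by positivity
  linarith [norm_nonneg t]

theorem aeval_homogenization {D : MvPolynomial (Fin m) ℚ} {e : ℕ}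
    {G : MvPolynomial (Fin (m + 1)) ℚ}
    (hG : algebraMap _ (RatFun (m + 1)) G = RatFun.coord 0 ^ e * homogenizePoly m D)
    {z : Fin (m + 1) → ℂ} (hz : z 0 ≠ 0) : MvPolynomial.aeval z G =
      z 0 ^ e * MvPolynomial.aeval (fun k => z k.succ / z 0) D := by
  rw [← (RatFun.hasValue_algebraMap G z).value_eq, hG]
  exact (((RatFun.hasValue_coord 0 z).pow e).mul (RatFun.hasValue_homogenizePoly D hz)).value_eq

/-- With `G` a homogenization of `D`, the cone is the zero set of `z₀ G`. The Łojasiewicz inequality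
bounds `|z₀ G|` from below by a power of the distance, and all three terms of `growth` are bounded
by multiples of `‖z‖ ^ (1 + e) / |z₀ G(z)|`. -/
theorem growth_le_div_infDist {D : MvPolynomial (Fin m) ℚ} (hD : D ≠ 0) :
    ∃ (K : ℝ) (N : ℕ), ∀ z ∉ zeroCone D, 0 < Metric.infDist z (zeroCone D) / ‖z‖ ∧
      growth D (fun k => z k.succ / z 0) ≤ K / (Metric.infDist z (zeroCone D) / ‖z‖) ^ N := by
  obtain ⟨e, G, hhom, hG⟩ := exists_homogenization D
  have hG0 : G ≠ 0 := by
    rintro rfl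
    have h0 : (RatFun.coord 0 : RatFun (m + 1)) ≠ 0 := fun h =>
      MvPolynomial.X_ne_zero (R := ℚ) (0 : Fin (m + 1))
        (IsFractionRing.injective (MvPolynomial (Fin (m + 1)) ℚ) (RatFun (m + 1))
          (h.trans (map_zero _).symm))
    rw [map_zero] at hG
    rcases mul_eq_zero.1 hG.symm with h | h
    · exact pow_ne_zero _ h0 h
    · exact hD (homogenizePoly_injective m (h.trans (map_zero _).symm))
  have hcone : zeroCone D = {z | MvPolynomial.aeval z (MvPolynomial.X 0 * G) = 0} := by
    ext z
    simp only [zeroCone, Set.mem_ofPred_eq, map_mul, MvPolynomial.aeval_X, mul_eq_zero]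
    by_cases hz : z 0 = 0
    · simp [hz]
    · simp [hz, aeval_homogenization hG hz]
  obtain ⟨K₁, hK₁, h₁⟩ := infDist_pow_le_of_isHomogeneous
    ((MvPolynomial.isHomogeneous_X ℚ (0 : Fin (m + 1))).mul hhom)
    (mul_ne_zero (MvPolynomial.X_ne_zero _) hG0)
  obtain ⟨K₂, hK₂, h₂⟩ := norm_aeval_le_of_isHomogeneous hhom
  rw [← hcone] at h₁
  refine ⟨(1 + K₂ + K₂ + 1) * K₁, 1 + e, fun z hz => ?_⟩
  have hclosed : IsClosed (zeroCone D) := by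
    rw [hcone]
    refine isClosed_eq ?_ continuous_const
    exact continuous_iff_continuousAt.2 fun w => (hasFDerivAt_aeval _ w).continuousAt
  have hz0 : z 0 ≠ 0 := fun h => hz (Or.inl h)
  have hDz : MvPolynomial.aeval (fun k : Fin m => z k.succ / z 0) D ≠ 0 := fun h => hz (Or.inr h)
  have hzpos : 0 < ‖z‖ := norm_pos_iff.2 fun h => hz0 (by simp [h])
  have hdpos : 0 < Metric.infDist z (zeroCone D) :=
    (hclosed.notMem_iff_infDist_pos ⟨0, Or.inl rfl⟩).1 hz
  have hδ : 0 < Metric.infDist z (zeroCone D) / ‖z‖ := by positivity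
  refine ⟨hδ, ?_⟩
  have hw : ‖z 0‖ / ‖z‖ ≤ 1 := (div_le_one hzpos).2 (norm_le_pi_norm z 0)
  have hw0 : 0 < ‖z 0‖ / ‖z‖ := div_pos (norm_pos_iff.2 hz0) hzpos
  -- In the scale-invariant quantities `w`, `δ` and `d = |D(z / z₀)|` one has `|z₀ G(z)| = w ^ (1 +
  -- e) * d * ‖z‖ ^ (1 + e)`, so homogeneity removes `‖z‖` from every estimate.
  obtain ⟨w, hwdef⟩ : ∃ w, w = ‖z 0‖ / ‖z‖ := ⟨_, rfl⟩
  obtain ⟨δ, hδdef⟩ : ∃ δ, δ = Metric.infDist z (zeroCone D) / ‖z‖ := ⟨_, rfl⟩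
  obtain ⟨d, hddef⟩ : ∃ d, d = ‖MvPolynomial.aeval (fun k : Fin m => z k.succ / z 0) D‖ := ⟨_, rfl⟩
  have hd0 : 0 < d := hddef ▸ norm_pos_iff.2 hDz
  have hGz : ‖MvPolynomial.aeval z G‖ = ‖z 0‖ ^ e * d := by
    rw [aeval_homogenization hG hz0, norm_mul, norm_pow, hddef]
  have hz0' : ‖z 0‖ = w * ‖z‖ := by rw [hwdef]; field_simp
  have hdist : Metric.infDist z (zeroCone D) = δ * ‖z‖ := by rw [hδdef]; field_simp
  have e₁ : δ ^ (1 + e) ≤ K₁ * (w ^ (1 + e) * d) := by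
    have := h₁ z
    rw [map_mul, MvPolynomial.aeval_X, norm_mul, hGz, hz0', hdist] at this
    have hp : 0 < ‖z‖ ^ (1 + e) := by positivity
    refine le_of_mul_le_mul_right ?_ hp
    calc _ = (δ * ‖z‖) ^ (1 + e) := by ring
      _ ≤ _ := this
      _ = _ := by ring
  have e₂ : w ^ e * d ≤ K₂ := by
    have := h₂ z
    rw [hGz, hz0'] at this
    have hp : 0 < ‖z‖ ^ e := by positivity
    refine le_of_mul_le_mul_right ?_ hp
    calc _ = (w * ‖z‖) ^ e * d := by ring
      _ ≤ _ := this
  have ht : ‖fun k : Fin m => z k.succ / z 0‖ ≤ w⁻¹ := by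
    rw [← hwdef] at hw0
    refine (pi_norm_le_iff_of_nonneg (by positivity)).2 fun k => ?_
    rw [norm_div, hwdef, inv_div]
    exact div_le_div_of_nonneg_right (norm_le_pi_norm z _) (norm_nonneg _)
  rw [← hwdef] at hw hw0
  rw [← hδdef] at hδ ⊢
  have hwe : w ^ (1 + e) ≤ 1 := pow_le_one₀ hw0.le hw
  have hpos : 0 < w ^ (1 + e) * d := by positivity
  have f₁ : 1 ≤ K₂ / (w ^ (1 + e) * d) := by
    rw [le_div_iff₀ hpos, one_mul]
    refine le_trans ?_ e₂
    exact mul_le_mul_of_nonneg_right (pow_le_pow_of_le_one hw0.le hw (by omega)) hd0.le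
  have f₂ : w⁻¹ ≤ K₂ / (w ^ (1 + e) * d) := by
    rw [le_div_iff₀ hpos]
    calc _ = w ^ e * d := by rw [pow_add, pow_one]; field_simp
      _ ≤ _ := e₂
  have f₃ : d⁻¹ ≤ 1 / (w ^ (1 + e) * d) := by
    rw [le_div_iff₀ hpos]
    calc _ = w ^ (1 + e) := by field_simp
      _ ≤ _ := hwe
  have f₄ : 1 / (w ^ (1 + e) * d) ≤ K₁ / δ ^ (1 + e) := by
    rw [div_le_div_iff₀ hpos (by positivity), one_mul]
    exact e₁
  unfold growth
  rw [← hddef]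
  calc 1 + ‖fun k : Fin m => z k.succ / z 0‖ + d⁻¹
      ≤ K₂ / (w ^ (1 + e) * d) + K₂ / (w ^ (1 + e) * d) + 1 / (w ^ (1 + e) * d) :=
        add_le_add (add_le_add f₁ (ht.trans f₂)) f₃
    _ = (K₂ + K₂ + 1) * (1 / (w ^ (1 + e) * d)) := by ring
    _ ≤ (1 + K₂ + K₂ + 1) * (K₁ / δ ^ (1 + e)) := by
        refine mul_le_mul (by linarith) f₄ (by positivity) (by positivity)
    _ = _ := by ring

end CP

/-! ### Derivatives of matrix functions and local uniqueness of solutions -/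

theorem DifferentiableAt.matrix_det_apply {E : Type*} [NormedAddCommGroup E] [NormedSpace ℂ E]
    {n : ℕ} {M : E → Matrix (Fin n) (Fin n) ℂ} {x : E}
    (h : ∀ i j, DifferentiableAt ℂ (fun y => M y i j) x) :
    DifferentiableAt ℂ (fun y => (M y).det) x := by
  simp only [Matrix.det_apply']
  refine DifferentiableAt.fun_sum fun σ _ => ?_
  refine DifferentiableAt.fun_mul (differentiableAt_const _) ?_
  exact (HasFDerivAt.finsetProd fun i _ => (h (σ i) i).hasFDerivAt).differentiableAt

theorem DifferentiableAt.matrix_inv_apply {E : Type*} [NormedAddCommGroup E] [NormedSpace ℂ E]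
    {n : ℕ} {M : E → Matrix (Fin n) (Fin n) ℂ} {x : E}
    (h : ∀ i j, DifferentiableAt ℂ (fun y => M y i j) x) (hdet : (M x).det ≠ 0) (i j : Fin n) :
    DifferentiableAt ℂ (fun y => (M y)⁻¹ i j) x := by
  simp only [Matrix.inv_def, Matrix.smul_apply, Ring.inverse_eq_inv', Matrix.adjugate_apply,
    smul_eq_mul]
  refine DifferentiableAt.fun_mul ?_ ?_
  · exact (differentiableAt_inv hdet).comp x (DifferentiableAt.matrix_det_apply h)
  · refine DifferentiableAt.matrix_det_apply fun a b => ?_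
    by_cases hab : a = j
    · subst hab
      simp
    · simpa [Matrix.updateRow_ne hab] using h a b

theorem fderiv_matrix_mul_apply {E : Type*} [NormedAddCommGroup E] [NormedSpace ℂ E]
    {n : ℕ} {M N : E → Matrix (Fin n) (Fin n) ℂ} {x : E}
    (hM : ∀ i j, DifferentiableAt ℂ (fun y => M y i j) x)
    (hN : ∀ i j, DifferentiableAt ℂ (fun y => N y i j) x) (v : E) :
    (Matrix.of fun i j => fderiv ℂ (fun y => (M y * N y) i j) x v) =
      (Matrix.of fun i j => fderiv ℂ (fun y => M y i j) x v) * N x +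
        M x * (Matrix.of fun i j => fderiv ℂ (fun y => N y i j) x v) := by
  ext i j
  simp only [Matrix.mul_apply, Matrix.of_apply, Matrix.add_apply]
  rw [(HasFDerivAt.fun_sum fun l _ =>
    (hM i l).hasFDerivAt.fun_mul (hN l j).hasFDerivAt).fderiv, ← Finset.sum_add_distrib]
  simp only [FunLike.coe_sum, Finset.sum_apply, add_apply,
    smul_apply, smul_eq_mul]
  exact Finset.sum_congr rfl fun l _ => by ring

namespace PfaffianSystem

variable {m n : ℕ} {Ω : PfaffianSystem m n}

theorem AffineSolvesAt.fderiv_eq {X : (Fin m → ℂ) → Matrix (Fin n) (Fin n) ℂ} {t : Fin m → ℂ}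
    (h : Ω.AffineSolvesAt X t) (v : Fin m → ℂ) :
    (Matrix.of fun i j => fderiv ℂ (fun y => X y i j) t v) =
      (Matrix.of fun i l => ∑ k, (Ω.coeff k i l).value t * v k) * X t := by
  ext i j
  simp only [Matrix.mul_apply, Matrix.of_apply, (h i j).fderiv]
  simp only [FunLike.coe_sum, Finset.sum_apply, smul_apply,
    ContinuousLinearMap.proj_apply, smul_eq_mul, Finset.sum_mul]
  rw [Finset.sum_comm]
  exact Finset.sum_congr rfl fun _ _ => Finset.sum_congr rfl fun _ _ => by ring

/-- Two fundamental solutions differ locally by a constant matrix. -/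
theorem eventually_eq_mul_const {S X : (Fin m → ℂ) → Matrix (Fin n) (Fin n) ℂ} {t : Fin m → ℂ}
    (hS : ∀ᶠ t' in 𝓝 t, Ω.AffineSolvesAt S t' ∧ (S t').det ≠ 0)
    (hX : ∀ᶠ t' in 𝓝 t, Ω.AffineSolvesAt X t') :
    ∀ᶠ t' in 𝓝 t, X t' = S t' * ((S t)⁻¹ * X t) := by
  obtain ⟨ε, hε, hball⟩ := Metric.eventually_nhds_iff_ball.1 (hS.and hX)
  have hdS : ∀ t' ∈ Metric.ball t ε, ∀ i j, DifferentiableAt ℂ (fun y => S y i j) t' :=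
    fun t' ht' i j => ((hball t' ht').1.1 i j).differentiableAt
  have hdX : ∀ t' ∈ Metric.ball t ε, ∀ i j, DifferentiableAt ℂ (fun y => X y i j) t' :=
    fun t' ht' i j => ((hball t' ht').2 i j).differentiableAt
  have hdI : ∀ t' ∈ Metric.ball t ε, ∀ i j, DifferentiableAt ℂ (fun y => (S y)⁻¹ i j) t' :=
    fun t' ht' => DifferentiableAt.matrix_inv_apply (hdS t' ht') (hball t' ht').1.2
  have hunit : ∀ t' ∈ Metric.ball t ε, IsUnit (S t').det := fun t' ht' =>
    (hball t' ht').1.2.isUnit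
  have hdP : ∀ t' ∈ Metric.ball t ε, ∀ i j,
      DifferentiableAt ℂ (fun y => ((S y)⁻¹ * X y) i j) t' := by
    intro t' ht' i j
    simp only [Matrix.mul_apply]
    exact DifferentiableAt.fun_sum fun l _ => (hdI t' ht' i l).fun_mul (hdX t' ht' l j)
  -- Differentiating `S⁻¹ S = 1` gives `d(S⁻¹) = -S⁻¹ Ω`, whence `d(S⁻¹ X) = -S⁻¹ Ω X + S⁻¹ Ω X =
  -- 0`.
  have hzero : ∀ t' ∈ Metric.ball t ε, ∀ i j,
      fderiv ℂ (fun y => ((S y)⁻¹ * X y) i j) t' = 0 := by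
    intro t' ht' i j
    ext v
    have h1 := fderiv_matrix_mul_apply (hdI t' ht') (hdX t' ht') v
    have h2 := fderiv_matrix_mul_apply (hdI t' ht') (hdS t' ht') v
    have h3 : (Matrix.of fun i j => fderiv ℂ (fun y => ((S y)⁻¹ * S y) i j) t' v) = 0 := by
      ext a b
      have : (fun y => ((S y)⁻¹ * S y) a b) =ᶠ[𝓝 t']
          fun _ => (1 : Matrix (Fin n) (Fin n) ℂ) a b := by
        filter_upwards [Metric.isOpen_ball.mem_nhds ht'] with y hy
        rw [Matrix.nonsing_inv_mul _ (hunit y hy)]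
      simp only [Matrix.of_apply, this.fderiv_eq]
      simp
    rw [h3, (hball t' ht').1.1.fderiv_eq v, ← mul_assoc, ← add_mul] at h2
    have h4 : (Matrix.of fun i j => fderiv ℂ (fun y => (S y)⁻¹ i j) t' v) +
        (S t')⁻¹ * (Matrix.of fun i l => ∑ k, (Ω.coeff k i l).value t' * v k) = 0 := by
      have := congrArg (· * (S t')⁻¹) h2.symm
      simpa only [zero_mul, Matrix.mul_nonsing_inv_cancel_right _ _ (hunit t' ht')] using this
    rw [(hball t' ht').2.fderiv_eq v, ← mul_assoc, ← add_mul, h4, zero_mul] at h1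
    exact congrFun (congrFun h1 i) j
  filter_upwards [Metric.ball_mem_nhds t hε] with t' ht'
  have hconst : (S t')⁻¹ * X t' = (S t)⁻¹ * X t := by
    ext i j
    exact Metric.isOpen_ball.is_const_of_fderiv_eq_zero
      (convex_ball t ε).isPreconnected
      (fun y hy => (hdP y hy i j).differentiableWithinAt) (fun y hy => hzero y hy i j)
      ht' (Metric.mem_ball_self hε)
  rw [← hconst, Matrix.mul_nonsing_inv_cancel_left _ _ (hunit t' ht')]

/-! ### Frame fields, and why they make a Q-system -/

variable (Ω) in
/-- A finitely-valued field of fundamental matrices of `Ω` off the hypersurface `D = 0`: the values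
at `t` form a torsor `fr t` under a set `Γ` of constant matrices of finite order, they are local
restrictions of solutions, they grow polynomially, and `Ω` has poles at infinity and on `D = 0`. -/
structure IsFrameField (D : MvPolynomial (Fin m) ℚ)
    (fr : (Fin m → ℂ) → Set (Matrix (Fin n) (Fin n) ℂ)) (Γ : Set (Matrix (Fin n) (Fin n) ℂ)) :
    Prop where
  ne_zero : D ≠ 0
  regularAt : ∀ t, MvPolynomial.aeval t D ≠ 0 → ∀ k i j, (Ω.coeff k i j).RegularAt t
  nonempty : ∀ t, MvPolynomial.aeval t D ≠ 0 → (fr t).Nonempty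
  det_ne_zero : ∀ t, MvPolynomial.aeval t D ≠ 0 → ∀ V ∈ fr t, V.det ≠ 0
  exists_section : ∀ t, MvPolynomial.aeval t D ≠ 0 → ∀ V ∈ fr t,
    ∃ S : (Fin m → ℂ) → Matrix (Fin n) (Fin n) ℂ, S t = V ∧
      ∀ᶠ t' in 𝓝 t, S t' ∈ fr t' ∧ Ω.AffineSolvesAt S t'
  mul_mem : ∀ t, ∀ V ∈ fr t, ∀ g ∈ Γ, V * g ∈ fr t
  exists_mul : ∀ t, MvPolynomial.aeval t D ≠ 0 → ∀ V ∈ fr t, ∀ W ∈ fr t, ∃ g ∈ Γ, W = V * g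
  finite_order : ∀ g ∈ Γ, ∃ k : ℕ, 0 < k ∧ g ^ k = 1
  bound : ∃ (K : ℝ) (N : ℕ), ∀ t, MvPolynomial.aeval t D ≠ 0 → ∀ V ∈ fr t, ∀ i j,
    ‖V i j‖ ≤ K * CP.growth D t ^ N ∧ ‖V⁻¹ i j‖ ≤ K * CP.growth D t ^ N
  mem_polarLocus : ∀ z (hz : z ≠ 0), z ∈ CP.zeroCone D →
    Projectivization.mk ℂ z hz ∈ Ω.polarLocus

/-- The constant matrices `C` with `X ∈ fr t · C`. -/
def frameClass (fr : (Fin m → ℂ) → Set (Matrix (Fin n) (Fin n) ℂ)) (t : Fin m → ℂ)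
    (X : Matrix (Fin n) (Fin n) ℂ) : Set (Matrix (Fin n) (Fin n) ℂ) :=
  {C | ∃ V ∈ fr t, X = V * C}

namespace IsFrameField

variable {D : MvPolynomial (Fin m) ℚ} {fr : (Fin m → ℂ) → Set (Matrix (Fin n) (Fin n) ℂ)}
  {Γ : Set (Matrix (Fin n) (Fin n) ℂ)}

theorem eventually_aeval_ne_zero {t : Fin m → ℂ} (ht : MvPolynomial.aeval t D ≠ 0) :
    ∀ᶠ t' in 𝓝 t, MvPolynomial.aeval t' D ≠ 0 :=
  (hasFDerivAt_aeval D t).continuousAt.eventually_ne ht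

/-- Since `fr t` is the orbit `V Γ`, the class depends only on `C₀`, not on `V` or `t`. It is
therefore an invariant that can be compared at different points. -/
theorem frameClass_eq (h : Ω.IsFrameField D fr Γ)
    {t : Fin m → ℂ} (ht : MvPolynomial.aeval t D ≠ 0)
    {V : Matrix (Fin n) (Fin n) ℂ} (hV : V ∈ fr t) (C₀ : Matrix (Fin n) (Fin n) ℂ) :
    frameClass fr t (V * C₀) = {C | ∃ g ∈ Γ, C₀ = g * C} := by
  have hu : IsUnit V.det := (h.det_ne_zero t ht V hV).isUnit
  ext C
  constructor
  · rintro ⟨W, hW, e⟩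
    obtain ⟨g, hg, rfl⟩ := h.exists_mul t ht V hV W hW
    refine ⟨g, hg, ?_⟩
    have := congrArg (V⁻¹ * ·) e
    simpa only [mul_assoc, Matrix.nonsing_inv_mul_cancel_left _ _ hu] using this
  · rintro ⟨g, hg, rfl⟩
    exact ⟨V * g, h.mul_mem t V hV g hg, (mul_assoc _ _ _).symm⟩

/-- A solution is locally `S C₀` for a section `S` of the frames and a constant `C₀`, and by
`frameClass_eq` the class sees only `C₀`. -/
theorem eventually_frameClass_eq (h : Ω.IsFrameField D fr Γ)
    {t : Fin m → ℂ} (ht : MvPolynomial.aeval t D ≠ 0)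
    {X : (Fin m → ℂ) → Matrix (Fin n) (Fin n) ℂ} (hX : ∀ᶠ t' in 𝓝 t, Ω.AffineSolvesAt X t') :
    ∀ᶠ t' in 𝓝 t, frameClass fr t' (X t') = frameClass fr t (X t) := by
  obtain ⟨V, hV⟩ := h.nonempty t ht
  obtain ⟨S, rfl, hS⟩ := h.exists_section t ht V hV
  have hS' : ∀ᶠ t' in 𝓝 t, Ω.AffineSolvesAt S t' ∧ (S t').det ≠ 0 := by
    filter_upwards [hS, eventually_aeval_ne_zero ht] with t' h1 h2
    exact ⟨h1.2, h.det_ne_zero t' h2 _ h1.1⟩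
  have key := eventually_eq_mul_const hS' hX
  have h0 : X t = S t * ((S t)⁻¹ * X t) := key.self_of_nhds
  filter_upwards [key, hS, eventually_aeval_ne_zero ht] with t' h1 h2 h3
  rw [h1, h.frameClass_eq h3 h2.1]
  conv_rhs => rw [h0]
  rw [h.frameClass_eq ht hV]

theorem exists_affine_of_notMem (h : Ω.IsFrameField D fr Γ)
    {p : CP m} (hp : p ∉ Ω.polarLocus) :
    ∃ t, p = CP.affine t ∧ MvPolynomial.aeval t D ≠ 0 := by
  induction p using Projectivization.ind with
  | h z hz =>
    have hc : z ∉ CP.zeroCone D := fun hc => hp (h.mem_polarLocus z hz hc)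
    exact ⟨_, (CP.affine_div hz fun h0 => hc (Or.inl h0)).symm, fun h0 => hc (Or.inr h0)⟩

theorem notMem_polarLocus (h : Ω.IsFrameField D fr Γ)
    {t : Fin m → ℂ} (ht : MvPolynomial.aeval t D ≠ 0) :
    CP.affine t ∉ Ω.polarLocus := by
  rintro ⟨z, hz, hzt, a, i, j, hreg⟩
  have hzt' := hzt
  rw [CP.affine, Projectivization.mk_eq_mk_iff'] at hzt'
  obtain ⟨c, hc⟩ := hzt'
  have h0 : z 0 ≠ 0 := by
    rw [← hc]
    intro h0
    apply hz
    have : c = 0 := by simpa using h0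
    rw [← hc, this, zero_smul]
  have ht' : (fun k : Fin m => z k.succ / z 0) = t := by
    rw [← CP.coords_mk z hz, hzt, CP.coords_affine]
  have hr : ∀ k, (Ω.coeff k i j).RegularAt fun k => z k.succ / z 0 := by
    rw [ht']
    exact fun k => h.regularAt t ht k i j
  refine hreg (Fin.cases ?_ (fun k => ?_) a)
  · exact (hasValue_homCoeff_zero h0 i j hr).regularAt
  · exact (hasValue_homCoeff_succ h0 k i j (hr k)).regularAt

theorem eventually_frameClass_coords_eq (h : Ω.IsFrameField D fr Γ)
    {p : CP m} (hp : p ∉ Ω.polarLocus)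
    {Y : CP m → Matrix (Fin n) (Fin n) ℂ} (hY : Ω.IsFundamentalNear Y p) :
    ∀ᶠ q in 𝓝 p, frameClass fr q.coords (Y q) = frameClass fr p.coords (Y p) := by
  obtain ⟨t, rfl, ht⟩ := h.exists_affine_of_notMem hp
  rw [CP.eventually_nhds_affine]
  have hY' := CP.eventually_nhds_affine.1 hY
  have hX : ∀ᶠ t' in 𝓝 t, Ω.AffineSolvesAt (fun t' => Y (CP.affine t')) t' := by
    filter_upwards [hY', eventually_aeval_ne_zero ht] with t' h1 h2
    exact h1.1.affineSolvesAt (h.regularAt t' h2)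
  filter_upwards [h.eventually_frameClass_eq ht hX] with t' h1
  simpa only [CP.coords_affine] using h1

theorem isFundamentalNear_section (h : Ω.IsFrameField D fr Γ)
    {t : Fin m → ℂ} (ht : MvPolynomial.aeval t D ≠ 0)
    {S : (Fin m → ℂ) → Matrix (Fin n) (Fin n) ℂ}
    (hS : ∀ᶠ t' in 𝓝 t, S t' ∈ fr t' ∧ Ω.AffineSolvesAt S t') :
    Ω.IsFundamentalNear (fun p => S p.coords) (CP.affine t) := by
  refine CP.eventually_nhds_affine.2 ?_
  filter_upwards [hS, eventually_aeval_ne_zero ht] with t' h1 h2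
  refine ⟨h1.2.solvesAt (h.regularAt t' h2), ?_⟩
  rw [CP.coords_affine]
  exact h.det_ne_zero t' h2 _ h1.1

/-- Through every point off the polar locus there is a nondegenerate solution, and the integrability
condition is the symmetry of its second derivatives. -/
theorem isFlat (h : Ω.IsFrameField D fr Γ) : Ω.IsFlat := by
  rintro z ⟨hz, hzS⟩ a b i j
  obtain ⟨t, hzt, ht⟩ := h.exists_affine_of_notMem hzS
  obtain ⟨V, hV⟩ := h.nonempty t ht
  obtain ⟨S, -, hS⟩ := h.exists_section t ht V hV
  have hX := h.isFundamentalNear_section ht hS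
  obtain ⟨X, hXdef⟩ : ∃ X : CP m → Matrix (Fin n) (Fin n) ℂ, X = fun p => S p.coords := ⟨_, rfl⟩
  rw [← hXdef, ← hzt] at hX
  have hreg : ∀ a i j, (Ω.homCoeff a i j).RegularAt z := by
    intro a i j
    by_contra hcon
    exact hzS ⟨z, hz, rfl, a, i, j, hcon⟩
  have hmk : ∀ᶠ w in 𝓝 z, ∃ hw : w ≠ 0, Ω.SolvesAt X (Projectivization.mk ℂ w hw) := by
    have h1 : ∀ᶠ w in 𝓝[{w | w ≠ 0}] z,
        ∃ hw : w ≠ 0, Ω.SolvesAt X (Projectivization.mk ℂ w hw) := by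
      rw [nhdsWithin_eq_map_subtype_coe (show z ∈ {w | w ≠ 0} from hz), Filter.eventually_map]
      have := (CP.continuous_mk (m := m)).continuousAt (x := ⟨z, hz⟩) hX
      filter_upwards [this] with w hw
      exact ⟨w.2, hw.1⟩
    rwa [isOpen_ne.nhdsWithin_eq hz] at h1
  have hcol : ∀ (i j : Fin n),
      fderiv ℂ (fun w => ∑ l, (Ω.homCoeff b i l).value w * CP.pullback (fun q => X q l j) w) z
        (Pi.single a 1) =
      fderiv ℂ (fun w => ∑ l, (Ω.homCoeff a i l).value w * CP.pullback (fun q => X q l j) w) z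
        (Pi.single b 1) := by
    intro i j
    have hd : ∀ c, DifferentiableAt ℂ
        (fun w => ∑ l, (Ω.homCoeff c i l).value w * CP.pullback (fun q => X q l j) w) z := by
      intro c
      refine DifferentiableAt.fun_sum fun l _ => ?_
      obtain ⟨_, hs⟩ := hmk.self_of_nhds
      exact (hreg c i l).differentiableAt.fun_mul (hs z hz rfl l j).differentiableAt
    have hf : ∀ᶠ w in 𝓝 z, HasFDerivAt (CP.pullback fun q => X q i j)
        (∑ c, (∑ l, (Ω.homCoeff c i l).value w * CP.pullback (fun q => X q l j) w) •
          ContinuousLinearMap.proj (R := ℂ) (φ := fun _ : Fin (m + 1) => ℂ) c) w := by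
      filter_upwards [hmk] with w hw
      obtain ⟨hw0, hs⟩ := hw
      have := hs w hw0 rfl i j
      simpa only [CP.pullback_apply _ hw0] using this
    have hx := HasFDerivAt.fun_sum (u := Finset.univ) fun c _ => (hd c).hasFDerivAt.smul_const
      (ContinuousLinearMap.proj (R := ℂ) (φ := fun _ : Fin (m + 1) => ℂ) c)
    have := second_derivative_symmetric_of_eventually hf hx (Pi.single a 1) (Pi.single b 1)
    simpa [Pi.single_apply] using this
  obtain ⟨_, hs⟩ := hmk.self_of_nhds
  have hprod : ∀ c d i j,
      fderiv ℂ (fun w => ∑ l, (Ω.homCoeff c i l).value w * CP.pullback (fun q => X q l j) w) z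
        (Pi.single d 1) =
      ∑ l, (fderiv ℂ (fun w => (Ω.homCoeff c i l).value w) z (Pi.single d 1) +
        ∑ q, (Ω.homCoeff c i q).value z * (Ω.homCoeff d q l).value z) *
          X (Projectivization.mk ℂ z hz) l j := by
    intro c d i j
    rw [(HasFDerivAt.fun_sum fun l _ => (hreg c i l).differentiableAt.hasFDerivAt.fun_mul
      (hs z hz rfl l j)).fderiv]
    simp only [CP.pullback_apply _ hz]
    simp only [FunLike.coe_sum, Finset.sum_apply, add_apply, smul_apply, smul_eq_mul,
      ContinuousLinearMap.proj_apply, Pi.single_apply, mul_ite, mul_one, mul_zero,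
      Finset.sum_ite_eq', Finset.mem_univ, if_true, Finset.sum_add_distrib, add_mul]
    rw [add_comm]
    congr 1
    · exact Finset.sum_congr rfl fun _ _ => mul_comm _ _
    · simp only [Finset.mul_sum, Finset.sum_mul]
      rw [Finset.sum_comm]
      exact Finset.sum_congr rfl fun _ _ => Finset.sum_congr rfl fun _ _ => by ring
  -- Expanding `∂ₐ(B_b X) = ∂_b(Bₐ X)` with `∂X = B X` gives `(∂ₐB_b + B_b Bₐ - ∂_bBₐ - Bₐ B_b) X =
  -- 0`, and `X` is invertible.
  have hmat : (Matrix.of fun i l =>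
      (fderiv ℂ (fun w => (Ω.homCoeff b i l).value w) z (Pi.single a 1) +
        ∑ q, (Ω.homCoeff b i q).value z * (Ω.homCoeff a q l).value z) -
      (fderiv ℂ (fun w => (Ω.homCoeff a i l).value w) z (Pi.single b 1) +
        ∑ q, (Ω.homCoeff a i q).value z * (Ω.homCoeff b q l).value z)) *
          X (Projectivization.mk ℂ z hz) = 0 := by
    ext i j
    have := hcol i j
    rw [hprod, hprod] at this
    simp only [Matrix.mul_apply, Matrix.of_apply, sub_mul, Finset.sum_sub_distrib,
      Matrix.zero_apply]
    exact sub_eq_zero.2 this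
  have hdet : IsUnit (X (Projectivization.mk ℂ z hz)).det := hX.self_of_nhds.2.isUnit
  have hzero := congrArg (· * (X (Projectivization.mk ℂ z hz))⁻¹) hmat
  simp only [zero_mul, Matrix.mul_nonsing_inv_cancel_right _ _ hdet] at hzero
  have := congrFun (congrFun hzero i) j
  simp only [Matrix.of_apply, Matrix.zero_apply] at this
  rw [Finset.sum_sub_distrib]
  linear_combination this

/-- The polar locus is exactly the hypersurface `D = 0` together with infinity, so `CP.distTo`
measures the distance occurring in `CP.growth_le_div_infDist`. -/
theorem insert_cone_polarLocus (h : Ω.IsFrameField D fr Γ) :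
    insert 0 (CP.cone Ω.polarLocus) = CP.zeroCone D := by
  ext z
  by_cases hz : z = 0
  · subst hz
    simp [CP.zeroCone]
  · simp only [Set.mem_insert_iff, hz, false_or]
    constructor
    · rintro ⟨_, hmem⟩
      by_contra hc
      refine h.notMem_polarLocus (t := fun k => z k.succ / z 0) (fun h0 => hc (Or.inr h0)) ?_
      rwa [CP.affine_div hz fun h0 => hc (Or.inl h0)]
    · exact fun hc => ⟨hz, h.mem_polarLocus z hz hc⟩

theorem growth_le (h : Ω.IsFrameField D fr Γ) : ∃ (K : ℝ) (N : ℕ), ∀ p ∉ Ω.polarLocus,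
    0 < CP.distTo p Ω.polarLocus ∧
      CP.growth D p.coords ≤ K / CP.distTo p Ω.polarLocus ^ N := by
  obtain ⟨K, N, hK⟩ := CP.growth_le_div_infDist h.ne_zero
  refine ⟨K, N, fun p hp => ?_⟩
  have hz : p.rep ∉ CP.zeroCone D := fun hc => by
    have := h.mem_polarLocus p.rep p.rep_nonzero hc
    rw [Projectivization.mk_rep] at this
    exact hp this
  rw [CP.distTo, h.insert_cone_polarLocus]
  exact hK p.rep hz

/-- The class is locally constant along the connected set `U`, so one constant matrix `C` satisfies
`X(p) ∈ fr · C` at all points of `U`. The bounds for the frames and their inverses then pass to `X`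
and `X⁻¹`. -/
theorem isRegular (h : Ω.IsFrameField D fr Γ) : Ω.IsRegular := by
  intro U hU _ hdisj X hX
  have hUc : IsPreconnected U := hU.isPathConnected.isConnected.isPreconnected
  obtain ⟨p₀, hp₀⟩ := hU.isPathConnected.nonempty
  have hoff : ∀ p ∈ U, p ∉ Ω.polarLocus := fun p hp hs => Set.disjoint_left.1 hdisj hp hs
  have hconst : ∀ p ∈ U, frameClass fr p.coords (X p) = frameClass fr p₀.coords (X p₀) := by
    have : PreconnectedSpace U := isPreconnected_iff_preconnectedSpace.1 hUc
    have hloc : IsLocallyConstant fun p : U => frameClass fr p.1.coords (X p.1) := by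
      rw [IsLocallyConstant.iff_eventually_eq]
      intro p
      obtain ⟨Y, hY, hXY⟩ := hX p.1 p.2
      have h1 := (h.eventually_frameClass_coords_eq (hoff p.1 p.2) hY).filter_mono
        (nhdsWithin_le_nhds (s := U))
      have h2 : X p.1 = Y p.1 := hXY.self_of_nhdsWithin p.2
      have h3 : ∀ᶠ q in 𝓝[U] p.1,
          frameClass fr q.coords (X q) = frameClass fr p.1.coords (X p.1) := by
        filter_upwards [h1, hXY] with q hq hq'
        rw [hq', hq, h2]
      rw [nhdsWithin_eq_map_subtype_coe p.2, Filter.eventually_map] at h3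
      exact h3
    intro p hp
    exact hloc.apply_eq_of_preconnectedSpace ⟨p, hp⟩ ⟨p₀, hp₀⟩
  obtain ⟨t₀, ht₀, hD₀⟩ := h.exists_affine_of_notMem (hoff p₀ hp₀)
  obtain ⟨V₀, hV₀⟩ := h.nonempty t₀ hD₀
  have hu₀ : IsUnit V₀.det := (h.det_ne_zero t₀ hD₀ V₀ hV₀).isUnit
  obtain ⟨C, hC⟩ : ∃ C, C ∈ frameClass fr p₀.coords (X p₀) := by
    refine ⟨V₀⁻¹ * X p₀, V₀, ?_, (Matrix.mul_nonsing_inv_cancel_left _ _ hu₀).symm⟩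
    rwa [ht₀, CP.coords_affine]
  obtain ⟨K₁, N₁, h₁⟩ := h.growth_le
  obtain ⟨K₂, N₂, h₂⟩ := h.bound
  obtain ⟨L, hL⟩ : ∃ L : ℝ, L = ∑ i, ∑ j, (‖C i j‖ + ‖C⁻¹ i j‖) := ⟨_, rfl⟩
  have hL0 : 0 ≤ L := hL ▸ Finset.sum_nonneg fun i _ => Finset.sum_nonneg fun j _ => by positivity
  have hle : ∀ i j, ‖C i j‖ + ‖C⁻¹ i j‖ ≤ L := fun i j => by
    rw [hL]
    refine le_trans ?_ (Finset.single_le_sum (f := fun i => ∑ j, (‖C i j‖ + ‖C⁻¹ i j‖))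
      (fun i _ => Finset.sum_nonneg fun j _ => by positivity) (Finset.mem_univ i))
    exact Finset.single_le_sum (f := fun j => (‖C i j‖ + ‖C⁻¹ i j‖))
      (fun j _ => by positivity) (Finset.mem_univ j)
  -- Entries of `V C` and of `C⁻¹ V⁻¹` are sums of `n` products of size at most `|K₂| * growth ^ N₂
  -- * L`, and `growth` is at most `K₁ / dist ^ N₁`. The factor `2` adds the two bounds.
  refine ⟨2 * (n * (|K₂| * K₁ ^ N₂ * L)), N₁ * N₂, fun p hp i j => ?_⟩
  obtain ⟨t, rfl, hD⟩ := h.exists_affine_of_notMem (hoff p hp)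
  obtain ⟨V, hV, hXV⟩ : C ∈ frameClass fr (CP.affine t).coords (X (CP.affine t)) := by
    rwa [hconst _ hp]
  rw [CP.coords_affine] at hV
  obtain ⟨hδ, hgr⟩ := h₁ _ (hoff _ hp)
  rw [CP.coords_affine] at hgr
  have hVb := h₂ t hD V hV
  have hg1 := CP.one_le_growth D t
  have hG : |K₂| * CP.growth D t ^ N₂ ≤
      |K₂| * K₁ ^ N₂ / CP.distTo (CP.affine t) Ω.polarLocus ^ (N₁ * N₂) := by
    rw [mul_div_assoc, pow_mul, ← div_pow]
    gcongr
  have hKG : K₂ * CP.growth D t ^ N₂ ≤ |K₂| * CP.growth D t ^ N₂ := by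
    gcongr
    exact le_abs_self _
  have hinv : (X (CP.affine t))⁻¹ = C⁻¹ * V⁻¹ := by rw [hXV, Matrix.mul_inv_rev]
  have hB : 0 ≤ |K₂| * CP.growth D t ^ N₂ := by positivity
  have b₁ : ‖X (CP.affine t) i j‖ ≤ n * (|K₂| * CP.growth D t ^ N₂ * L) := by
    rw [hXV, Matrix.mul_apply]
    refine (norm_sum_le_of_le _ (f := fun l => V i l * C l j) (n := fun _ =>
      |K₂| * CP.growth D t ^ N₂ * L) fun l _ => ?_).trans_eq (by simp)
    rw [norm_mul]
    exact mul_le_mul ((hVb i l).1.trans hKG) (by linarith [hle l j, norm_nonneg (C⁻¹ l j)])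
      (norm_nonneg _) hB
  have b₂ : ‖(X (CP.affine t))⁻¹ i j‖ ≤ n * (|K₂| * CP.growth D t ^ N₂ * L) := by
    rw [hinv, Matrix.mul_apply]
    refine (norm_sum_le_of_le _ (f := fun l => C⁻¹ i l * V⁻¹ l j) (n := fun _ =>
      |K₂| * CP.growth D t ^ N₂ * L) fun l _ => ?_).trans_eq (by simp)
    rw [norm_mul, mul_comm]
    exact mul_le_mul ((hVb l j).2.trans hKG) (by linarith [hle i l, norm_nonneg (C i l)])
      (norm_nonneg _) hB
  calc _ ≤ n * (|K₂| * CP.growth D t ^ N₂ * L) + n * (|K₂| * CP.growth D t ^ N₂ * L) :=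
        add_le_add b₁ b₂
    _ = 2 * n * L * (|K₂| * CP.growth D t ^ N₂) := by ring
    _ ≤ 2 * n * L * (|K₂| * K₁ ^ N₂ / CP.distTo (CP.affine t) Ω.polarLocus ^ (N₁ * N₂)) := by
        gcongr
    _ = _ := by ring

/-- The class of the continued solution is the same at both ends of the loop, which forces `C M = g
C` for some `g ∈ Γ`. So `M` is conjugate to a matrix of finite order. -/
theorem isQuasiunipotent (h : Ω.IsFrameField D fr Γ) : Ω.IsQuasiunipotent := by
  intro γ ε hγ M ⟨Y, hY, hM⟩ μ hμ
  obtain ⟨ψ, hψ, hγψ⟩ := hγ.holomorphic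
  have hmem : ∀ s : unitInterval, (ε * Complex.exp (2 * Real.pi * Complex.I * (s : ℝ)) : ℂ) ∈
      Metric.closedBall (0 : ℂ) ε := by
    intro s
    have : (2 * Real.pi * Complex.I * (s : ℝ) : ℂ) = ((2 * Real.pi * s : ℝ) : ℂ) * Complex.I := by
      push_cast
      ring
    rw [mem_closedBall_zero_iff, norm_mul, this, Complex.norm_exp_ofReal_mul_I, mul_one,
      Complex.norm_real, Real.norm_of_nonneg hγ.pos.le]
  have hoff : ∀ s, smallLoop γ ε s ∉ Ω.polarLocus := fun s =>
    hγ.off _ (hmem s) (mul_ne_zero (by exact_mod_cast hγ.pos.ne') (Complex.exp_ne_zero _))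
  have hcont : Continuous (smallLoop γ ε) := by
    have h1 : Continuous fun s : unitInterval =>
        ψ (ε * Complex.exp (2 * Real.pi * Complex.I * (s : ℝ))) :=
      hψ.continuousOn.comp_continuous (by fun_prop) hmem
    have h2 := CP.continuous_mk.comp (h1.subtype_mk fun s => (hγψ _ (hmem s)).1)
    convert h2 using 1
    funext s
    exact (hγψ _ (hmem s)).2
  have hloop : smallLoop γ ε 1 = smallLoop γ ε 0 := by
    simp [smallLoop, Complex.exp_two_pi_mul_I]
  have hloc : IsLocallyConstant fun s =>
      frameClass fr (smallLoop γ ε s).coords (Y s (smallLoop γ ε s)) := by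
    rw [IsLocallyConstant.iff_eventually_eq]
    intro s
    have h1 := hcont.continuousAt (x := s) (h.eventually_frameClass_coords_eq (hoff s) (hY s).1)
    filter_upwards [h1, (hY s).2] with s' h2 h3
    rw [h3.self_of_nhds]
    exact h2
  have hcls := hloc.apply_eq_of_preconnectedSpace 1 0
  simp only [hloop] at hcls
  rw [show Y 1 (smallLoop γ ε 0) = Y 0 (smallLoop γ ε 0) * M from hM.self_of_nhds] at hcls
  obtain ⟨t, ht, hD⟩ := h.exists_affine_of_notMem (hoff 0)
  obtain ⟨V, hV⟩ := h.nonempty t hD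
  have hu : IsUnit V.det := (h.det_ne_zero t hD V hV).isUnit
  have hYu : IsUnit (Y 0 (smallLoop γ ε 0)).det := (hY 0).1.self_of_nhds.2.isUnit
  obtain ⟨C, hC⟩ : ∃ C, C = V⁻¹ * Y 0 (smallLoop γ ε 0) := ⟨_, rfl⟩
  have hYC : Y 0 (smallLoop γ ε 0) = V * C := by
    rw [hC, Matrix.mul_nonsing_inv_cancel_left _ _ hu]
  rw [hYC, ht, CP.coords_affine, mul_assoc, h.frameClass_eq hD hV] at hcls
  -- `C` lies in the class of `V C`, which equals the class of `V C M`; reading off membership there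
  -- produces `g` with `C M = g C`.
  have hCmem : C ∈ frameClass fr t (V * C) := ⟨V, hV, rfl⟩
  rw [← hcls] at hCmem
  obtain ⟨g, hg, hgC⟩ := hCmem
  obtain ⟨k, hk, hgk⟩ := h.finite_order g hg
  have hCu : IsUnit C.det := by
    rw [hYC, Matrix.det_mul] at hYu
    exact isUnit_of_mul_isUnit_right hYu
  have hpow : ∀ k : ℕ, C * M ^ k = g ^ k * C := by
    intro k
    induction k with
    | zero => simp
    | succ k ih => rw [pow_succ, ← mul_assoc, ih, mul_assoc, hgC, ← mul_assoc, ← pow_succ]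
  have hMk : M ^ k = 1 := by
    have := congrArg (C⁻¹ * ·) (hpow k)
    simpa only [hgk, one_mul, Matrix.nonsing_inv_mul_cancel_left _ _ hCu,
      Matrix.nonsing_inv_mul _ hCu] using this
  refine ⟨k, hk, ?_⟩
  obtain ⟨v, hv⟩ := hμ.exists_hasEigenvector
  have h1 := hv.pow_apply k
  rw [← Matrix.toLin'_pow, hMk, Matrix.toLin'_one, LinearMap.id_apply] at h1
  by_contra hne
  have h2 : (μ ^ k - 1) • v = 0 := by rw [sub_smul, ← h1, one_smul, sub_self]
  exact (smul_eq_zero.1 h2).elim (fun h3 => hne (sub_eq_zero.1 h3)) hv.2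

theorem isQSystem (h : Ω.IsFrameField D fr Γ) : Ω.IsQSystem :=
  ⟨h.isFlat, h.isRegular, h.isQuasiunipotent⟩

end IsFrameField

end PfaffianSystem

/-! ### Division and separability over a domain, up to constants -/

section ClearingDenominators

variable {R : Type*} [CommRing R]

theorem map_fractionRing_injective :
    Function.Injective (Polynomial.map (algebraMap R (FractionRing R))) :=
  Polynomial.map_injective _ (IsFractionRing.injective R (FractionRing R))

variable [IsDomain R]

theorem exists_map_eq_C_mul (f : Polynomial (FractionRing R)) :
    ∃ (b : R) (f₀ : Polynomial R), b ≠ 0 ∧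
      f₀.map (algebraMap R (FractionRing R)) = Polynomial.C (algebraMap R _ b) * f := by
  obtain ⟨b, hb, h⟩ := IsLocalization.integerNormalization_spec (nonZeroDivisors R) f
  refine ⟨b, _, nonZeroDivisors.ne_zero hb, h.trans ?_⟩
  rw [← Polynomial.smul_eq_C_mul, algebraMap_smul]

/-- Division with remainder in `R[y]`, up to a factor from `R`. -/
theorem exists_mul_eq_mul_add (Q g : Polynomial R) (hQ : 0 < Q.natDegree) :
    ∃ (b : R) (q r : Polynomial R), b ≠ 0 ∧ r.natDegree < Q.natDegree ∧
      Polynomial.C b * g = q * Q + r := by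
  obtain ⟨φ, hφ⟩ : ∃ φ, φ = algebraMap R (FractionRing R) := ⟨_, rfl⟩
  have hinj : Function.Injective φ := hφ ▸ IsFractionRing.injective R (FractionRing R)
  obtain ⟨b₁, q, hb₁, hq⟩ := exists_map_eq_C_mul (g.map φ / Q.map φ)
  obtain ⟨b₂, r, hb₂, hr⟩ := exists_map_eq_C_mul (g.map φ % Q.map φ)
  rw [← hφ] at hq hr
  have hr' : r.natDegree = (g.map φ % Q.map φ).natDegree := by
    rw [← Polynomial.natDegree_map_eq_of_injective hinj r, hr,
      Polynomial.natDegree_C_mul fun h => hb₂ (hinj (h.trans (map_zero φ).symm))]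
  refine ⟨b₁ * b₂, Polynomial.C b₂ * q, Polynomial.C b₁ * r, mul_ne_zero hb₁ hb₂, ?_, ?_⟩
  · rw [Polynomial.natDegree_C_mul hb₁, hr', ← Polynomial.natDegree_map_eq_of_injective hinj Q]
    refine Polynomial.natDegree_mod_lt _ ?_
    rw [Polynomial.natDegree_map_eq_of_injective hinj]
    omega
  · apply map_fractionRing_injective
    rw [← hφ]
    simp only [Polynomial.map_add, Polynomial.map_mul, Polynomial.map_C, hq, hr, map_mul]
    linear_combination (-Polynomial.C (φ b₁) * Polynomial.C (φ b₂)) *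
      (EuclideanDomain.div_add_mod (g.map φ) (Q.map φ))

/-- Every nonzero polynomial divides, up to constants, a power of a polynomial `Q` which is
separable over the field of fractions and has degree at least `2`. -/
theorem exists_separable_dvd_pow [Algebra ℚ R] {P : Polynomial R} (hP : P ≠ 0) :
    ∃ (Q a b S : Polynomial R) (c : R) (N : ℕ), 2 ≤ Q.natDegree ∧ c ≠ 0 ∧
      a * Q + b * Polynomial.derivative Q = Polynomial.C c ∧
      Polynomial.C c * Q ^ N = P * S := by
  classical
  obtain ⟨φ, hφ⟩ : ∃ φ, φ = algebraMap R (FractionRing R) := ⟨_, rfl⟩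
  have hinj : Function.Injective φ := hφ ▸ IsFractionRing.injective R (FractionRing R)
  have : CharZero (FractionRing R) := algebraRat.charZero _
  have hP' : P.map φ ≠ 0 := (Polynomial.map_ne_zero_iff hinj).2 hP
  -- The extra factor `y (y - 1)` makes the radical have degree at least `2`, even for constant `P`.
  -- The Vandermonde matrix then has a row of first powers, where the roots themselves appear.
  obtain ⟨P₁, hP₁⟩ : ∃ P₁, P₁ = P.map φ * (Polynomial.X * (Polynomial.X - Polynomial.C 1)) :=
    ⟨_, rfl⟩
  have hP₁0 : P₁ ≠ 0 := by
    rw [hP₁]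
    exact mul_ne_zero hP' (mul_ne_zero Polynomial.X_ne_zero (Polynomial.X_sub_C_ne_zero 1))
  obtain ⟨N, hN⟩ := UniqueFactorizationMonoid.exists_dvd_radical_self_pow hP₁0
  obtain ⟨rad, hrad⟩ : ∃ rad, rad = UniqueFactorizationMonoid.radical P₁ := ⟨_, rfl⟩
  have hsep : rad.Separable := by
    rw [hrad, PerfectField.separable_iff_squarefree]
    exact UniqueFactorizationMonoid.squarefree_radical
  have hdvd : Polynomial.X * (Polynomial.X - Polynomial.C 1) ∣ rad := by
    rw [hrad]
    refine IsCoprime.mul_dvd ?_ ?_ ?_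
    · simpa using Polynomial.isCoprime_X_sub_C_of_isUnit_sub
        (show IsUnit ((0 : FractionRing R) - 1) by simp)
    · rw [UniqueFactorizationMonoid.dvd_radical_iff_of_irreducible Polynomial.irreducible_X hP₁0,
        hP₁]
      exact Dvd.dvd.mul_left (dvd_mul_right _ _) _
    · rw [UniqueFactorizationMonoid.dvd_radical_iff_of_irreducible
        (Polynomial.irreducible_X_sub_C 1) hP₁0, hP₁]
      exact Dvd.dvd.mul_left (dvd_mul_left _ _) _
  obtain ⟨u, Q, hu, hQ⟩ := exists_map_eq_C_mul rad
  rw [← hφ] at hQ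
  have hu' : IsUnit (Polynomial.C (φ u)) := by
    rw [Polynomial.isUnit_C, isUnit_iff_ne_zero]
    exact fun h => hu (hinj (h.trans (map_zero φ).symm))
  have hQsep : (Q.map φ).Separable := by
    rw [hQ]
    exact Polynomial.Separable.unit_mul hu' hsep
  obtain ⟨a, b, hab⟩ := hQsep
  obtain ⟨w, hw⟩ : P.map φ ∣ Q.map φ ^ N := by
    refine Dvd.dvd.trans (hP₁ ▸ dvd_mul_right _ _) (hN.trans ?_)
    rw [hQ, ← hrad]
    exact pow_dvd_pow_of_dvd (dvd_mul_left _ _) N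
  obtain ⟨ca, a₀, hca, ha₀⟩ := exists_map_eq_C_mul a
  obtain ⟨cb, b₀, hcb, hb₀⟩ := exists_map_eq_C_mul b
  obtain ⟨cw, w₀, hcw, hw₀⟩ := exists_map_eq_C_mul w
  rw [← hφ] at ha₀ hb₀ hw₀
  -- One constant `c = ca * cb * cw` serves both identities, so each cofactor is multiplied by the
  -- denominators it lacks.
  refine ⟨Q, Polynomial.C (cb * cw) * a₀, Polynomial.C (ca * cw) * b₀,
    Polynomial.C (ca * cb) * w₀, ca * cb * cw, N, ?_, mul_ne_zero (mul_ne_zero hca hcb) hcw,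
    ?_, ?_⟩
  · rw [← Polynomial.natDegree_map_eq_of_injective hinj Q]
    have h1 : (Polynomial.X * (Polynomial.X - Polynomial.C (1 : FractionRing R))).natDegree =
        2 := by
      rw [Polynomial.natDegree_mul Polynomial.X_ne_zero (Polynomial.X_sub_C_ne_zero 1),
        Polynomial.natDegree_X, Polynomial.natDegree_X_sub_C]
    rw [← h1]
    refine Polynomial.natDegree_le_of_dvd (hdvd.trans (hQ ▸ dvd_mul_left _ _)) ?_
    rw [hQ]
    exact mul_ne_zero hu'.ne_zero hsep.ne_zero
  · apply map_fractionRing_injective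
    rw [← hφ]
    rw [Polynomial.derivative_map] at hab
    simp only [Polynomial.map_add, Polynomial.map_mul, Polynomial.map_C, ha₀, hb₀, map_mul]
    linear_combination
      (Polynomial.C (φ ca) * Polynomial.C (φ cb) * Polynomial.C (φ cw)) * hab
  · apply map_fractionRing_injective
    rw [← hφ]
    simp only [Polynomial.map_pow, Polynomial.map_mul, Polynomial.map_C, hw₀, map_mul]
    linear_combination
      (Polynomial.C (φ ca) * Polynomial.C (φ cb) * Polynomial.C (φ cw)) * hw

end ClearingDenominators

/-! ### Evaluation of polynomials `P(t, y)` -/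

section Evaluation

variable {m : ℕ}

/-- The evaluation `P ↦ P(t, y)`. -/
def evalPair (t : Fin m → ℂ) (y : ℂ) : Polynomial (MvPolynomial (Fin m) ℚ) →+* ℂ :=
  Polynomial.eval₂RingHom (MvPolynomial.aeval t : MvPolynomial (Fin m) ℚ →ₐ[ℚ] ℂ).toRingHom y

theorem evalPair_apply (t : Fin m → ℂ) (y : ℂ) (P : Polynomial (MvPolynomial (Fin m) ℚ)) :
    evalPair t y P =
      P.eval₂ (MvPolynomial.aeval t : MvPolynomial (Fin m) ℚ →ₐ[ℚ] ℂ).toRingHom y := rfl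

theorem evalPair_eq_eval_map (t : Fin m → ℂ) (y : ℂ) (P : Polynomial (MvPolynomial (Fin m) ℚ)) :
    evalPair t y P =
      (P.map (MvPolynomial.aeval t : MvPolynomial (Fin m) ℚ →ₐ[ℚ] ℂ).toRingHom).eval y := by
  rw [evalPair_apply, Polynomial.eval_map]

@[simp] theorem evalPair_C (t : Fin m → ℂ) (y : ℂ) (c : MvPolynomial (Fin m) ℚ) :
    evalPair t y (Polynomial.C c) = MvPolynomial.aeval t c :=
  Polynomial.eval₂_C _ _

@[simp] theorem evalPair_X (t : Fin m → ℂ) (y : ℂ) : evalPair t y Polynomial.X = y :=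
  Polynomial.eval₂_X _ _

theorem evalPair_monomial (t : Fin m → ℂ) (y : ℂ) (n : ℕ) (c : MvPolynomial (Fin m) ℚ) :
    evalPair t y (Polynomial.monomial n c) = MvPolynomial.aeval t c * y ^ n :=
  Polynomial.eval₂_monomial _ _

theorem evalPair_eq_sum (t : Fin m → ℂ) (y : ℂ) {P : Polynomial (MvPolynomial (Fin m) ℚ)} {n : ℕ}
    (h : P.natDegree < n) :
    evalPair t y P = ∑ i : Fin n, MvPolynomial.aeval t (P.coeff i) * y ^ (i : ℕ) := by
  rw [evalPair_apply, Polynomial.eval₂_eq_sum_range' _ h, Finset.sum_range]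
  rfl

theorem exists_hasFDerivAt_evalPair (P : Polynomial (MvPolynomial (Fin m) ℚ)) :
    ∃ P' : Fin m → Polynomial (MvPolynomial (Fin m) ℚ), ∀ (t : Fin m → ℂ) (y : ℂ),
      HasFDerivAt (fun x : (Fin m → ℂ) × ℂ => evalPair x.1 x.2 P)
        (∑ k, evalPair t y (P' k) • (ContinuousLinearMap.proj (R := ℂ) (φ := fun _ : Fin m => ℂ) k
          ∘L ContinuousLinearMap.fst ℂ (Fin m → ℂ) ℂ) +
          evalPair t y (Polynomial.derivative P) • ContinuousLinearMap.snd ℂ (Fin m → ℂ) ℂ)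
        (t, y) := by
  induction P using Polynomial.induction_on' with
  | add p q hp hq =>
    obtain ⟨p', hp'⟩ := hp
    obtain ⟨q', hq'⟩ := hq
    refine ⟨p' + q', fun t y => ?_⟩
    simp only [map_add, Pi.add_apply]
    refine ((hp' t y).fun_add (hq' t y)).congr_fderiv ?_
    rw [add_add_add_comm, ← Finset.sum_add_distrib, ← add_smul]
    simp only [← add_smul]
  | monomial n c =>
    refine ⟨fun k => Polynomial.monomial n (MvPolynomial.pderiv k c), fun t y => ?_⟩
    simp only [evalPair_monomial, Polynomial.derivative_monomial]
    have h1 := HasFDerivAt.comp (f := Prod.fst) (t, y) (hasFDerivAt_aeval c t) hasFDerivAt_fst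
    have hsnd : HasFDerivAt (fun x : (Fin m → ℂ) × ℂ => x.2)
      (ContinuousLinearMap.snd ℂ (Fin m → ℂ) ℂ) (t, y) := hasFDerivAt_snd
    have h2 := (hasDerivAt_pow n y).comp_hasFDerivAt (t, y) hsnd
    refine (h1.fun_mul h2).congr_fderiv ?_
    ext v
    · simp [Finset.mul_sum]
      exact Finset.sum_congr rfl fun _ _ => by ring
    · simp
      ring

theorem contDiff_aeval (c : MvPolynomial (Fin m) ℚ) :
    ContDiff ℂ 1 fun t : Fin m → ℂ => MvPolynomial.aeval t c := by
  induction c using MvPolynomial.induction_on with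
  | C c =>
    simp only [MvPolynomial.aeval_C]
    exact contDiff_const
  | add p q hp hq =>
    simp only [map_add]
    exact hp.add hq
  | mul_X p a hp =>
    simp only [map_mul, MvPolynomial.aeval_X]
    exact hp.mul (contDiff_apply ℂ ℂ a)

theorem contDiff_evalPair (P : Polynomial (MvPolynomial (Fin m) ℚ)) :
    ContDiff ℂ 1 fun x : (Fin m → ℂ) × ℂ => evalPair x.1 x.2 P := by
  induction P using Polynomial.induction_on' with
  | add p q hp hq =>
    simp only [map_add]
    exact hp.add hq
  | monomial n c =>
    simp only [evalPair_monomial]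
    exact ((contDiff_aeval c).comp contDiff_fst).mul (contDiff_snd.pow n)

/-- A simple root of `Q(t, ·)` extends to a holomorphic root near `t`. -/
theorem exists_root_function {Q : Polynomial (MvPolynomial (Fin m) ℚ)} {t : Fin m → ℂ} {y : ℂ}
    (h : evalPair t y Q = 0) (h' : evalPair t y (Polynomial.derivative Q) ≠ 0) :
    ∃ f : (Fin m → ℂ) → ℂ, f t = y ∧
      ∀ᶠ t' in 𝓝 t, evalPair t' (f t') Q = 0 ∧ DifferentiableAt ℂ f t' := by
  obtain ⟨Q', hQ'⟩ := exists_hasFDerivAt_evalPair Q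
  have hc : ContDiffAt ℂ 1 (fun x : (Fin m → ℂ) × ℂ => evalPair x.1 x.2 Q) (t, y) :=
    (contDiff_evalPair Q).contDiffAt
  have hinv : (fderiv ℂ (fun x : (Fin m → ℂ) × ℂ => evalPair x.1 x.2 Q) (t, y) ∘L
      ContinuousLinearMap.inr ℂ (Fin m → ℂ) ℂ).IsInvertible := by
    refine ⟨ContinuousLinearEquiv.smulLeft (Units.mk0 _ h'), ?_⟩
    ext
    rw [(hQ' t y).fderiv]
    simp [Units.smul_def]
  refine ⟨hc.implicitFunction one_ne_zero hinv,
    hc.implicitFunction_apply_self one_ne_zero hinv, ?_⟩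
  have h1 := hc.eventually_apply_implicitFunction one_ne_zero hinv
  have h2 : ∀ᶠ t' in 𝓝 t, ContDiffAt ℂ 1 (hc.implicitFunction one_ne_zero hinv) t' :=
    (hc.contDiffAt_implicitFunction one_ne_zero hinv).eventually (by simp)
  filter_upwards [h1, h2] with t' h3 h4
  exact ⟨h3.trans h, h4.differentiableAt one_ne_zero⟩

end Evaluation

/-! ### Polynomially bounded functions -/

section PolynomiallyBounded

variable {α : Type*} {ρ : α → ℝ} {φ ψ : α → ℂ}

/-- `φ` is bounded by a power of the scale `ρ`. -/
def PolynomiallyBounded (ρ : α → ℝ) (φ : α → ℂ) : Prop :=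
  ∃ (K : ℝ) (N : ℕ), 0 ≤ K ∧ ∀ x, ‖φ x‖ ≤ K * ρ x ^ N

theorem polynomiallyBounded_const (c : ℂ) : PolynomiallyBounded ρ fun _ => c :=
  ⟨‖c‖, 0, norm_nonneg c, fun _ => by simp⟩

theorem PolynomiallyBounded.mono (hψ : PolynomiallyBounded ρ ψ) (h : ∀ x, ‖φ x‖ ≤ ‖ψ x‖) :
    PolynomiallyBounded ρ φ := by
  obtain ⟨K, N, hK, hb⟩ := hψ
  exact ⟨K, N, hK, fun x => (h x).trans (hb x)⟩

theorem PolynomiallyBounded.neg (hφ : PolynomiallyBounded ρ φ) :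
    PolynomiallyBounded ρ fun x => -φ x :=
  hφ.mono fun x => by simp

theorem PolynomiallyBounded.ofReal_norm (hφ : PolynomiallyBounded ρ φ) :
    PolynomiallyBounded ρ fun x => ((‖φ x‖ : ℝ) : ℂ) :=
  hφ.mono fun x => by simp

theorem PolynomiallyBounded.mul (hφ : PolynomiallyBounded ρ φ) (hψ : PolynomiallyBounded ρ ψ) :
    PolynomiallyBounded ρ fun x => φ x * ψ x := by
  obtain ⟨K, N, hK, h⟩ := hφ
  obtain ⟨K', N', hK', h'⟩ := hψ
  refine ⟨K * K', N + N', mul_nonneg hK hK', fun x => ?_⟩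
  rw [norm_mul]
  calc ‖φ x‖ * ‖ψ x‖ ≤ (K * ρ x ^ N) * (K' * ρ x ^ N') :=
        mul_le_mul (h x) (h' x) (norm_nonneg _) ((norm_nonneg _).trans (h x))
    _ = _ := by ring

theorem PolynomiallyBounded.add (hρ : ∀ x, 1 ≤ ρ x) (hφ : PolynomiallyBounded ρ φ)
    (hψ : PolynomiallyBounded ρ ψ) : PolynomiallyBounded ρ fun x => φ x + ψ x := by
  obtain ⟨K, N, hK, h⟩ := hφ
  obtain ⟨K', N', hK', h'⟩ := hψ
  refine ⟨K + K', N + N', add_nonneg hK hK', fun x => ?_⟩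
  have h1 : ρ x ^ N ≤ ρ x ^ (N + N') := pow_le_pow_right₀ (hρ x) (by omega)
  have h2 : ρ x ^ N' ≤ ρ x ^ (N + N') := pow_le_pow_right₀ (hρ x) (by omega)
  calc ‖φ x + ψ x‖ ≤ ‖φ x‖ + ‖ψ x‖ := norm_add_le _ _
    _ ≤ K * ρ x ^ N + K' * ρ x ^ N' := add_le_add (h x) (h' x)
    _ ≤ K * ρ x ^ (N + N') + K' * ρ x ^ (N + N') := by gcongr
    _ = _ := by ring

theorem PolynomiallyBounded.sum (hρ : ∀ x, 1 ≤ ρ x) {ι : Type*} (S : Finset ι) {φ : ι → α → ℂ}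
    (h : ∀ i ∈ S, PolynomiallyBounded ρ (φ i)) :
    PolynomiallyBounded ρ fun x => ∑ i ∈ S, φ i x := by
  classical
  induction S using Finset.induction_on with
  | empty => simpa using polynomiallyBounded_const 0
  | insert a S ha ih =>
    simp only [Finset.sum_insert ha]
    exact (h a (by simp)).add hρ (ih fun i hi => h i (Finset.mem_insert_of_mem hi))

theorem PolynomiallyBounded.pow (hφ : PolynomiallyBounded ρ φ) (n : ℕ) :
    PolynomiallyBounded ρ fun x => φ x ^ n := by
  induction n with
  | zero => simpa using polynomiallyBounded_const 1
  | succ n ih =>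
    simp only [pow_succ]
    exact ih.mul hφ

theorem PolynomiallyBounded.exists_uniform (hρ : ∀ x, 1 ≤ ρ x) {ι : Type*} [Fintype ι]
    {φ : ι → α → ℂ} (h : ∀ i, PolynomiallyBounded ρ (φ i)) :
    ∃ (K : ℝ) (N : ℕ), 0 ≤ K ∧ ∀ i x, ‖φ i x‖ ≤ K * ρ x ^ N := by
  obtain ⟨K, N, hK, hb⟩ := PolynomiallyBounded.sum hρ Finset.univ fun i _ => (h i).ofReal_norm
  refine ⟨K, N, hK, fun i x => le_trans ?_ (hb x)⟩
  beta_reduce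
  rw [← Complex.ofReal_sum, Complex.norm_real,
    Real.norm_of_nonneg (Finset.sum_nonneg fun _ _ => norm_nonneg _)]
  exact Finset.single_le_sum (f := fun i => ‖φ i x‖) (fun _ _ => norm_nonneg _)
    (Finset.mem_univ i)

end PolynomiallyBounded

/-! ### The unipotent block -/

section Unipotent

variable {m : ℕ}

/-- The unipotent matrix `(1 + g e₀ᵀ)(1 + τ e₀ e₁ᵀ)`. -/
def unipotentFrame (g : Fin (m + 1) → ℂ) (τ : ℂ) :
    Matrix (Fin (m + 1) ⊕ Fin 2) (Fin (m + 1) ⊕ Fin 2) ℂ :=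
  Matrix.fromBlocks 1 (Matrix.of fun j => ![g j, τ * g j]) 0 !![1, τ; 0, 1]

/-- The inverse of `unipotentFrame`. -/
def unipotentFrameInv (g : Fin (m + 1) → ℂ) (τ : ℂ) :
    Matrix (Fin (m + 1) ⊕ Fin 2) (Fin (m + 1) ⊕ Fin 2) ℂ :=
  Matrix.fromBlocks 1 (Matrix.of fun j => ![-g j, 0]) 0 !![1, -τ; 0, 1]

theorem unipotentFrameInv_mul (g : Fin (m + 1) → ℂ) (τ : ℂ) :
    unipotentFrameInv g τ * unipotentFrame g τ = 1 := by
  rw [unipotentFrameInv, unipotentFrame, Matrix.fromBlocks_multiply, ← Matrix.fromBlocks_one]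
  congr 1
  · simp
  · ext j a
    fin_cases a <;> simp [Matrix.mul_apply, Fin.sum_univ_two, mul_comm]
  · simp
  · ext a b
    fin_cases a <;> fin_cases b <;> simp

end Unipotent

/-! ### The system of an algebraic function -/

/-- A polynomial `Q(t, y)` together with a Bézout identity for `Q` and `∂Q/∂y`, the expressions of
the derivatives of the powers of a root through these powers, and a polynomial `D(t)` which is a
multiple of all denominators. -/
structure SeparableEquation (m : ℕ) where
  /-- The equation. -/
  Q : Polynomial (MvPolynomial (Fin m) ℚ)
  two_le : 2 ≤ Q.natDegree
  /-- The cofactor of `Q`. -/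
  a : Polynomial (MvPolynomial (Fin m) ℚ)
  /-- The cofactor of `∂Q/∂y`. -/
  b : Polynomial (MvPolynomial (Fin m) ℚ)
  /-- The value of the Bézout combination. -/
  c : MvPolynomial (Fin m) ℚ
  bezout : a * Q + b * Polynomial.derivative Q = Polynomial.C c
  /-- The partial derivatives of `Q` with respect to the `t_k`. -/
  dQ : Fin m → Polynomial (MvPolynomial (Fin m) ℚ)
  hasFDerivAt : ∀ (t : Fin m → ℂ) (y : ℂ),
    HasFDerivAt (fun x : (Fin m → ℂ) × ℂ => evalPair x.1 x.2 Q)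
      (∑ k, evalPair t y (dQ k) • (ContinuousLinearMap.proj (R := ℂ) (φ := fun _ : Fin m => ℂ) k
        ∘L ContinuousLinearMap.fst ℂ (Fin m → ℂ) ℂ) +
        evalPair t y (Polynomial.derivative Q) • ContinuousLinearMap.snd ℂ (Fin m → ℂ) ℂ) (t, y)
  /-- The denominators in the division by `Q`. -/
  den : Fin m → Fin Q.natDegree → MvPolynomial (Fin m) ℚ
  /-- The quotients in the division by `Q`. -/
  quo : Fin m → Fin Q.natDegree → Polynomial (MvPolynomial (Fin m) ℚ)
  /-- The remainders in the division by `Q`. -/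
  rem : Fin m → Fin Q.natDegree → Polynomial (MvPolynomial (Fin m) ℚ)
  natDegree_rem : ∀ k i, (rem k i).natDegree < Q.natDegree
  division : ∀ k i, Polynomial.C (den k i) *
    (((i : ℕ) : Polynomial (MvPolynomial (Fin m) ℚ)) * Polynomial.X ^ ((i : ℕ) - 1) * dQ k * b) =
      quo k i * Q + rem k i
  /-- The common denominator. -/
  D : MvPolynomial (Fin m) ℚ
  ne_zero : D ≠ 0
  c_dvd : c ∣ D
  leadingCoeff_dvd : Q.leadingCoeff ∣ D
  den_dvd : ∀ k i, den k i ∣ D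

theorem aeval_ne_zero_of_dvd {m : ℕ} {p q : MvPolynomial (Fin m) ℚ} {t : Fin m → ℂ} (h : p ∣ q)
    (hq : MvPolynomial.aeval t q ≠ 0) : MvPolynomial.aeval t p ≠ 0 := by
  obtain ⟨r, rfl⟩ := h
  rw [map_mul] at hq
  exact left_ne_zero_of_mul hq

/-- The identity `c Q ^ N = P S` shows that a root of `P(t, ·)` is a root of `Q(t, ·)` whenever
`c(t) ≠ 0`, which `D(t) ≠ 0` ensures. -/
theorem exists_separableEquation {m : ℕ} {P : Polynomial (MvPolynomial (Fin m) ℚ)} (hP : P ≠ 0) :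
    ∃ E : SeparableEquation m, ∀ (t : Fin m → ℂ) (y : ℂ), MvPolynomial.aeval t E.D ≠ 0 →
      evalPair t y P = 0 → evalPair t y E.Q = 0 := by
  obtain ⟨Q, a, b, S, c, N, hdeg, hc, hbez, hpow⟩ := exists_separable_dvd_pow hP
  obtain ⟨dQ, hdQ⟩ := exists_hasFDerivAt_evalPair Q
  have hdiv := fun (k : Fin m) (i : Fin Q.natDegree) => exists_mul_eq_mul_add Q
    (((i : ℕ) : Polynomial (MvPolynomial (Fin m) ℚ)) * Polynomial.X ^ ((i : ℕ) - 1) * dQ k * b)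
    (by omega)
  choose den quo rem hden hrem hdiv using hdiv
  have hQ0 : Q ≠ 0 := by
    rintro rfl
    simp at hdeg
  refine ⟨⟨Q, hdeg, a, b, c, hbez, dQ, hdQ, den, quo, rem, hrem, hdiv,
    -- Off `D = 0` the roots stay simple (`c`), none escapes to infinity (the leading coefficient),
    -- and the divisions by `Q` specialize (`den`).
    c * Q.leadingCoeff * ∏ k, ∏ i, den k i, ?_, ?_, ?_, ?_⟩, ?_⟩
  · refine mul_ne_zero (mul_ne_zero hc (Polynomial.leadingCoeff_ne_zero.2 hQ0)) ?_
    exact Finset.prod_ne_zero_iff.2 fun k _ => Finset.prod_ne_zero_iff.2 fun i _ => hden k i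
  · exact Dvd.dvd.mul_right (dvd_mul_right _ _) _
  · exact Dvd.dvd.mul_right (dvd_mul_left _ _) _
  · intro k i
    refine Dvd.dvd.mul_left ?_ _
    exact (Finset.dvd_prod_of_mem (den k) (Finset.mem_univ i)).trans
      (Finset.dvd_prod_of_mem (fun k => ∏ i, den k i) (Finset.mem_univ k))
  · intro t y hD hy
    have hct : MvPolynomial.aeval t c ≠ 0 :=
      aeval_ne_zero_of_dvd (Dvd.dvd.mul_right (dvd_mul_right _ _) _) hD
    have := congrArg (evalPair t y) hpow
    rw [map_mul, map_mul, hy, zero_mul, evalPair_C, map_pow] at this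
    exact eq_zero_of_pow_eq_zero ((mul_eq_zero.1 this).resolve_left hct)

namespace SeparableEquation

variable {m : ℕ} (E : SeparableEquation m) {t : Fin m → ℂ} {y : ℂ}

theorem b_mul_derivative (hy : evalPair t y E.Q = 0) :
    evalPair t y E.b * evalPair t y (Polynomial.derivative E.Q) = MvPolynomial.aeval t E.c := by
  have := congrArg (evalPair t y) E.bezout
  rw [map_add, map_mul, map_mul, hy, mul_zero, zero_add, evalPair_C] at this
  exact this

theorem derivative_ne_zero (hD : MvPolynomial.aeval t E.D ≠ 0) (hy : evalPair t y E.Q = 0) :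
    evalPair t y (Polynomial.derivative E.Q) ≠ 0 := by
  have h := E.b_mul_derivative hy
  exact right_ne_zero_of_mul (h ▸ aeval_ne_zero_of_dvd E.c_dvd hD)

/-- The coefficients of the system satisfied by the powers of the roots. -/
def rootCoeff (k : Fin m) : Matrix (Fin E.Q.natDegree) (Fin E.Q.natDegree) (RatFun m) :=
  Matrix.of fun i l => -(algebraMap _ (RatFun m) ((E.rem k i).coeff l) /
    algebraMap _ (RatFun m) (E.den k i * E.c))

theorem hasValue_rootCoeff (hD : MvPolynomial.aeval t E.D ≠ 0) (k : Fin m)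
    (i l : Fin E.Q.natDegree) : (E.rootCoeff k i l).HasValue t
      (-(MvPolynomial.aeval t ((E.rem k i).coeff l) /
        (MvPolynomial.aeval t (E.den k i) * MvPolynomial.aeval t E.c))) := by
  have h := RatFun.hasValue_algebraMap (E.den k i * E.c) t
  rw [map_mul (MvPolynomial.aeval t)] at h
  exact ((RatFun.hasValue_algebraMap _ t).div h (mul_ne_zero
    (aeval_ne_zero_of_dvd (E.den_dvd k i) hD) (aeval_ne_zero_of_dvd E.c_dvd hD))).neg

/-- The right side is `∂(yⁱ)/∂tₖ` by implicit differentiation. At a root, `1 / Q_y = b / c`, and the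
numerator equals its remainder modulo `Q` up to the factor `den`. -/
theorem sum_rootCoeff_mul_pow (hD : MvPolynomial.aeval t E.D ≠ 0) (hy : evalPair t y E.Q = 0)
    (k : Fin m) (i : Fin E.Q.natDegree) :
    ∑ l, (E.rootCoeff k i l).value t * y ^ (l : ℕ) =
      -((i : ℕ) * y ^ ((i : ℕ) - 1) * evalPair t y (E.dQ k) /
        evalPair t y (Polynomial.derivative E.Q)) := by
  have hden := aeval_ne_zero_of_dvd (E.den_dvd k i) hD
  have hc := aeval_ne_zero_of_dvd E.c_dvd hD
  have hQ' := E.derivative_ne_zero hD hy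
  have h1 := congrArg (evalPair t y) (E.division k i)
  simp only [map_mul, map_add, hy, mul_zero, zero_add, evalPair_C, map_natCast, map_pow,
    evalPair_X] at h1
  rw [evalPair_eq_sum t y (E.natDegree_rem k i)] at h1
  have h2 : ∑ l, (E.rootCoeff k i l).value t * y ^ (l : ℕ) =
      -((∑ l : Fin E.Q.natDegree, MvPolynomial.aeval t ((E.rem k i).coeff l) * y ^ (l : ℕ)) /
        (MvPolynomial.aeval t (E.den k i) * MvPolynomial.aeval t E.c)) := by
    rw [Finset.sum_div, ← Finset.sum_neg_distrib]
    refine Finset.sum_congr rfl fun l _ => ?_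
    rw [(E.hasValue_rootCoeff hD k i l).value_eq]
    ring
  rw [h2, ← h1, neg_inj, ← E.b_mul_derivative hy]
  have hb : evalPair t y E.b ≠ 0 := left_ne_zero_of_mul ((E.b_mul_derivative hy).symm ▸ hc)
  field_simp

theorem hasFDerivAt_root_pow {f : (Fin m → ℂ) → ℂ} (hD : MvPolynomial.aeval t E.D ≠ 0)
    (hf : ∀ᶠ t' in 𝓝 t, evalPair t' (f t') E.Q = 0) (hd : DifferentiableAt ℂ f t)
    (i : Fin E.Q.natDegree) :
    HasFDerivAt (fun t' => f t' ^ (i : ℕ))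
      (∑ k, (∑ l, (E.rootCoeff k i l).value t * f t ^ (l : ℕ)) •
        ContinuousLinearMap.proj (R := ℂ) (φ := fun _ : Fin m => ℂ) k) t := by
  have hy := hf.self_of_nhds
  have hQ' := E.derivative_ne_zero hD hy
  have h1 := (E.hasFDerivAt t (f t)).comp t ((hasFDerivAt_id t).prodMk hd.hasFDerivAt)
  have h2 : HasFDerivAt ((fun x : (Fin m → ℂ) × ℂ => evalPair x.1 x.2 E.Q) ∘
      fun t' => (id t', f t')) (0 : (Fin m → ℂ) →L[ℂ] ℂ) t :=
    (hasFDerivAt_const (0 : ℂ) t).congr_of_eventuallyEq hf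
  have h3 := h1.unique h2
  refine ((hasDerivAt_pow (i : ℕ) (f t)).comp_hasFDerivAt t hd.hasFDerivAt).congr_fderiv ?_
  ext1 v
  have h4 := DFunLike.congr_fun h3 v
  simp only [E.sum_rootCoeff_mul_pow hD hy]
  simp only [ContinuousLinearMap.comp_apply, add_apply, FunLike.coe_sum, Finset.sum_apply,
    smul_apply, smul_eq_mul, ContinuousLinearMap.proj_apply, zero_apply,
    ContinuousLinearMap.coe_fst', ContinuousLinearMap.coe_snd', ContinuousLinearMap.prod_apply,
    ContinuousLinearMap.id_apply] at h4 ⊢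
  have h5 : fderiv ℂ f t v = -(∑ k, evalPair t (f t) (E.dQ k) * v k) /
      evalPair t (f t) (Polynomial.derivative E.Q) := by
    rw [eq_div_iff hQ']
    linear_combination h4
  rw [h5, neg_div, Finset.sum_div, mul_neg, Finset.mul_sum, ← Finset.sum_neg_distrib]
  exact Finset.sum_congr rfl fun k _ => by ring

/-- The degree of a homogenization of the common denominator. -/
def deg : ℕ := (exists_homogenization E.D).choose

/-- A homogenization of the common denominator. -/
def hom : MvPolynomial (Fin (m + 1)) ℚ := (exists_homogenization E.D).choose_spec.choose

theorem algebraMap_hom : algebraMap _ (RatFun (m + 1)) E.hom =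
    RatFun.coord 0 ^ E.deg * homogenizePoly m E.D :=
  (exists_homogenization E.D).choose_spec.choose_spec.2

/-- The numerators `1, t₁ᵉ, …, tₘᵉ`. -/
def numer (j : Fin (m + 1)) : MvPolynomial (Fin m) ℚ :=
  Fin.cases 1 (fun k => MvPolynomial.X k ^ E.deg) j

/-- The functions `1 / D, t₁ᵉ / D, …, tₘᵉ / D`. -/
def poleFun (j : Fin (m + 1)) (t : Fin m → ℂ) : ℂ :=
  MvPolynomial.aeval t (E.numer j) / MvPolynomial.aeval t E.D

/-- The derivatives of `poleFun`. -/
def poleDeriv (k : Fin m) (j : Fin (m + 1)) : RatFun m :=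
  algebraMap _ (RatFun m) (MvPolynomial.pderiv k (E.numer j) * E.D -
    E.numer j * MvPolynomial.pderiv k E.D) / algebraMap _ (RatFun m) (E.D ^ 2)

theorem hasValue_poleDeriv (hD : MvPolynomial.aeval t E.D ≠ 0) (k : Fin m) (j : Fin (m + 1)) :
    (E.poleDeriv k j).HasValue t
      ((MvPolynomial.aeval t (MvPolynomial.pderiv k (E.numer j)) * MvPolynomial.aeval t E.D -
        MvPolynomial.aeval t (E.numer j) * MvPolynomial.aeval t (MvPolynomial.pderiv k E.D)) /
          MvPolynomial.aeval t E.D ^ 2) := by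
  have h1 := RatFun.hasValue_algebraMap (MvPolynomial.pderiv k (E.numer j) * E.D -
    E.numer j * MvPolynomial.pderiv k E.D) t
  have h2 := RatFun.hasValue_algebraMap (E.D ^ 2) t
  convert h1.div h2 (by simpa using hD) using 1
  · rfl
  · simp only [map_sub, map_mul, map_pow]

theorem hasValue_poleFun (hD : MvPolynomial.aeval t E.D ≠ 0) (j : Fin (m + 1)) :
    (algebraMap _ (RatFun m) (E.numer j) / algebraMap _ (RatFun m) E.D).HasValue t
      (E.poleFun j t) :=
  (RatFun.hasValue_algebraMap _ t).div (RatFun.hasValue_algebraMap _ t) hD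

theorem hasFDerivAt_poleFun (hD : MvPolynomial.aeval t E.D ≠ 0) (j : Fin (m + 1)) :
    HasFDerivAt (E.poleFun j) (∑ k, (E.poleDeriv k j).value t •
      ContinuousLinearMap.proj (R := ℂ) (φ := fun _ : Fin m => ℂ) k) t := by
  have h1 := (hasFDerivAt_aeval (E.numer j) t).fun_mul
    ((hasDerivAt_inv hD).comp_hasFDerivAt t (hasFDerivAt_aeval E.D t))
  have e : E.poleFun j = fun t => MvPolynomial.aeval t (E.numer j) *
      (Inv.inv ∘ fun t => MvPolynomial.aeval t E.D) t := funext fun t => div_eq_mul_inv _ _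
  rw [e]
  refine h1.congr_fderiv ?_
  ext1 v
  simp only [(E.hasValue_poleDeriv hD _ j).value_eq]
  simp only [add_apply, FunLike.coe_sum, Finset.sum_apply, smul_apply, smul_eq_mul,
    ContinuousLinearMap.proj_apply, Function.comp_apply, Finset.mul_sum]
  rw [← Finset.sum_add_distrib]
  refine Finset.sum_congr rfl fun k _ => ?_
  field_simp
  ring

/-- The coefficients of the system satisfied by the unipotent block. -/
def unipotentCoeff (k : Fin m) :
    Matrix (Fin (m + 1) ⊕ Fin 2) (Fin (m + 1) ⊕ Fin 2) (RatFun m) :=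
  Matrix.fromBlocks 0 (Matrix.of fun j => ![E.poleDeriv k j,
    algebraMap _ (RatFun m) (E.numer j) / algebraMap _ (RatFun m) E.D]) 0 !![0, 1; 0, 0]

/-- The index set of the system. -/
abbrev Idx : Type := Fin E.Q.natDegree ⊕ (Fin (m + 1) ⊕ Fin 2)

/-- The coefficients of the system. -/
def fullCoeff (k : Fin m) : Matrix E.Idx E.Idx (RatFun m) :=
  Matrix.fromBlocks (E.rootCoeff k) 0 0 (E.unipotentCoeff k)

/-- The fundamental matrix at `t` belonging to the enumeration `r` of the roots of `Q(t, ·)`. -/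
def fullFrame (t : Fin m → ℂ) (r : Fin E.Q.natDegree → ℂ) : Matrix E.Idx E.Idx ℂ :=
  Matrix.fromBlocks (Matrix.of fun i j => r j ^ (i : ℕ)) 0 0
    (unipotentFrame (fun j => E.poleFun j t) (∑ k, t k))

theorem _root_.RatFun.value_zero {k : ℕ} (z : Fin k → ℂ) : (0 : RatFun k).value z = 0 :=
  (RatFun.hasValue_zero z).value_eq

theorem _root_.RatFun.hasValue_one {k : ℕ} (z : Fin k → ℂ) : (1 : RatFun k).HasValue z 1 := by
  have := RatFun.hasValue_algebraMap (1 : MvPolynomial (Fin k) ℚ) z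
  rwa [map_one, map_one] at this

theorem _root_.RatFun.value_one {k : ℕ} (z : Fin k → ℂ) : (1 : RatFun k).value z = 1 :=
  (RatFun.hasValue_one z).value_eq

theorem regularAt_fullCoeff (hD : MvPolynomial.aeval t E.D ≠ 0) (k : Fin m) (i j : E.Idx) :
    (E.fullCoeff k i j).RegularAt t := by
  have h0 := (RatFun.hasValue_zero t).regularAt
  have h1 := (RatFun.hasValue_one t).regularAt
  rcases i with i | i | i <;> rcases j with j | j | j
  · exact (E.hasValue_rootCoeff hD k i j).regularAt
  · exact h0
  · exact h0
  · exact h0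
  · exact h0
  · fin_cases j
    · exact (E.hasValue_poleDeriv hD k i).regularAt
    · exact (E.hasValue_poleFun hD i).regularAt
  · exact h0
  · exact h0
  · fin_cases i <;> fin_cases j
    · exact h0
    · exact h1
    · exact h0
    · exact h0

theorem hasFDerivAt_unipotentFrame (hD : MvPolynomial.aeval t E.D ≠ 0)
    (i j : Fin (m + 1) ⊕ Fin 2) :
    HasFDerivAt (fun t' => unipotentFrame (fun j => E.poleFun j t') (∑ k, t' k) i j)
      (∑ k, (∑ l, (E.unipotentCoeff k i l).value t *
        unipotentFrame (fun j => E.poleFun j t) (∑ k, t k) l j) •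
        ContinuousLinearMap.proj (R := ℂ) (φ := fun _ : Fin m => ℂ) k) t := by
  have hτ : HasFDerivAt (fun t' : Fin m → ℂ => ∑ k, t' k)
      (∑ k, ContinuousLinearMap.proj (R := ℂ) (φ := fun _ : Fin m => ℂ) k) t :=
    HasFDerivAt.fun_sum fun k _ => hasFDerivAt_apply k t
  have hg := E.hasFDerivAt_poleFun hD
  have hv := fun j => (E.hasValue_poleFun hD j).value_eq
  have hz := RatFun.value_zero t
  have ho := RatFun.value_one t
  simp only [Fintype.sum_sum_type, Fin.sum_univ_two]
  rcases i with i | i <;> rcases j with j | j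
  · exact (hasFDerivAt_const _ t).congr_fderiv (by
      ext v; simp [unipotentFrame, unipotentCoeff, hz])
  · fin_cases j
    · exact (hg i).congr_fderiv (by ext v; simp [unipotentFrame, unipotentCoeff, hz])
    · refine (hτ.fun_mul (hg i)).congr_fderiv ?_
      ext1 v
      simp [unipotentFrame, unipotentCoeff, hz, hv, add_mul, Finset.sum_add_distrib]
      rw [Finset.mul_sum, Finset.mul_sum]
      congr 1
      exact Finset.sum_congr rfl fun _ _ => by ring
  · exact (hasFDerivAt_const _ t).congr_fderiv (by
      ext v; simp [unipotentFrame, unipotentCoeff, hz])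
  · fin_cases i <;> fin_cases j
    · exact (hasFDerivAt_const _ t).congr_fderiv (by
        ext v; simp [unipotentFrame, unipotentCoeff, hz])
    · exact hτ.congr_fderiv (by ext v; simp [unipotentFrame, unipotentCoeff, hz, ho])
    · exact (hasFDerivAt_const _ t).congr_fderiv (by
        ext v; simp [unipotentFrame, unipotentCoeff, hz])
    · exact (hasFDerivAt_const _ t).congr_fderiv (by
        ext v; simp [unipotentFrame, unipotentCoeff, hz])

/-- The matrices are block diagonal, and each column of the Vandermonde block consists of the powers
of one root, so the two blocks can be differentiated separately. -/
theorem hasFDerivAt_fullFrame {f : Fin E.Q.natDegree → (Fin m → ℂ) → ℂ}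
    (hD : MvPolynomial.aeval t E.D ≠ 0)
    (hf : ∀ i, ∀ᶠ t' in 𝓝 t, evalPair t' (f i t') E.Q = 0)
    (hd : ∀ i, DifferentiableAt ℂ (f i) t) (i j : E.Idx) :
    HasFDerivAt (fun t' => E.fullFrame t' (fun a => f a t') i j)
      (∑ k, (∑ l, (E.fullCoeff k i l).value t * E.fullFrame t (fun a => f a t) l j) •
        ContinuousLinearMap.proj (R := ℂ) (φ := fun _ : Fin m => ℂ) k) t := by
  have hz := RatFun.value_zero t
  rcases i with i | i <;> rcases j with j | j
  · refine (E.hasFDerivAt_root_pow hD (hf j) (hd j) i).congr_fderiv ?_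
    simp only [Fintype.sum_sum_type (α₁ := Fin E.Q.natDegree)]
    simp [fullFrame, fullCoeff]
  · exact (hasFDerivAt_const _ t).congr_fderiv (by ext v; simp [fullFrame, fullCoeff, hz])
  · exact (hasFDerivAt_const _ t).congr_fderiv (by ext v; simp [fullFrame, fullCoeff, hz])
  · refine (E.hasFDerivAt_unipotentFrame hD i j).congr_fderiv ?_
    simp only [Fintype.sum_sum_type (α₁ := Fin E.Q.natDegree)]
    simp [fullFrame, fullCoeff]

end SeparableEquation

/-! ### Enumerations of the roots -/

namespace SeparableEquation

variable {m : ℕ} (E : SeparableEquation m) {t : Fin m → ℂ} {y : ℂ}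

/-- The polynomial `Q(t, ·)`. -/
def specialize (t : Fin m → ℂ) : Polynomial ℂ :=
  E.Q.map (MvPolynomial.aeval t : MvPolynomial (Fin m) ℚ →ₐ[ℚ] ℂ).toRingHom

theorem eval_specialize (t : Fin m → ℂ) (y : ℂ) :
    (E.specialize t).eval y = evalPair t y E.Q :=
  (evalPair_eq_eval_map t y E.Q).symm

theorem eval_derivative_specialize (t : Fin m → ℂ) (y : ℂ) :
    (Polynomial.derivative (E.specialize t)).eval y =
      evalPair t y (Polynomial.derivative E.Q) := by
  rw [specialize, Polynomial.derivative_map, ← evalPair_eq_eval_map]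

theorem natDegree_specialize (hD : MvPolynomial.aeval t E.D ≠ 0) :
    (E.specialize t).natDegree = E.Q.natDegree :=
  Polynomial.natDegree_map_of_leadingCoeff_ne_zero _
    (aeval_ne_zero_of_dvd E.leadingCoeff_dvd hD)

theorem specialize_ne_zero (hD : MvPolynomial.aeval t E.D ≠ 0) : E.specialize t ≠ 0 := by
  intro h
  have := E.natDegree_specialize hD
  rw [h, Polynomial.natDegree_zero] at this
  have := E.two_le
  omega

/-- The Bézout identity divided by `c(t)` shows that `Q(t, ·)` is separable, and its degree does not
drop because the leading coefficient survives. -/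
theorem card_roots_specialize (hD : MvPolynomial.aeval t E.D ≠ 0) :
    (E.specialize t).roots.toFinset.card = E.Q.natDegree := by
  have hsep : (E.specialize t).roots.Nodup := by
    refine (Polynomial.nodup_roots_iff_of_splits (E.specialize_ne_zero hD)
      (IsAlgClosed.splits _)).2 ?_
    refine ⟨E.a.map (MvPolynomial.aeval t : MvPolynomial (Fin m) ℚ →ₐ[ℚ] ℂ).toRingHom *
        Polynomial.C (MvPolynomial.aeval t E.c)⁻¹,
      E.b.map (MvPolynomial.aeval t : MvPolynomial (Fin m) ℚ →ₐ[ℚ] ℂ).toRingHom *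
        Polynomial.C (MvPolynomial.aeval t E.c)⁻¹, ?_⟩
    have h := congrArg (Polynomial.map
      (MvPolynomial.aeval t : MvPolynomial (Fin m) ℚ →ₐ[ℚ] ℂ).toRingHom) E.bezout
    have hc := aeval_ne_zero_of_dvd E.c_dvd hD
    have hC : Polynomial.C (MvPolynomial.aeval t E.c) *
        Polynomial.C (MvPolynomial.aeval t E.c)⁻¹ = 1 := by
      rw [← Polynomial.C_mul, mul_inv_cancel₀ hc, Polynomial.C_1]
    rw [Polynomial.map_add, Polynomial.map_mul, Polynomial.map_mul, Polynomial.map_C,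
      ← Polynomial.derivative_map] at h
    change _ = Polynomial.C (MvPolynomial.aeval t E.c) at h
    rw [specialize]
    linear_combination Polynomial.C (MvPolynomial.aeval t E.c)⁻¹ * h + hC
  rw [Multiset.toFinset_card_of_nodup hsep, ← (IsAlgClosed.splits _).natDegree_eq_card_roots,
    E.natDegree_specialize hD]

/-- `r` enumerates the roots of `Q(t, ·)`. -/
def IsEnumeration (t : Fin m → ℂ) (r : Fin E.Q.natDegree → ℂ) : Prop :=
  Function.Injective r ∧ ∀ i, evalPair t (r i) E.Q = 0

theorem mem_roots_specialize (hD : MvPolynomial.aeval t E.D ≠ 0) :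
    y ∈ (E.specialize t).roots.toFinset ↔ evalPair t y E.Q = 0 := by
  rw [Multiset.mem_toFinset, Polynomial.mem_roots (E.specialize_ne_zero hD), Polynomial.IsRoot.def,
    eval_specialize]

theorem exists_isEnumeration (hD : MvPolynomial.aeval t E.D ≠ 0) :
    ∃ r, E.IsEnumeration t r := by
  obtain ⟨f⟩ : Nonempty (Fin E.Q.natDegree ≃ (E.specialize t).roots.toFinset) :=
    ⟨(Fintype.equivFinOfCardEq (by simpa using E.card_roots_specialize hD)).symm⟩
  exact ⟨fun i => f i, fun i j h => f.injective (Subtype.ext h),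
    fun i => (E.mem_roots_specialize hD).1 (f i).2⟩

theorem IsEnumeration.exists_eq {E : SeparableEquation m} (hD : MvPolynomial.aeval t E.D ≠ 0)
    {r : Fin E.Q.natDegree → ℂ} (hr : E.IsEnumeration t r) (hy : evalPair t y E.Q = 0) :
    ∃ i, r i = y := by
  have h1 : Finset.univ.image r = (E.specialize t).roots.toFinset := by
    refine Finset.eq_of_subset_of_card_le ?_ ?_
    · intro x hx
      obtain ⟨i, -, rfl⟩ := Finset.mem_image.1 hx
      exact (E.mem_roots_specialize hD).2 (hr.2 i)
    · rw [Finset.card_image_of_injective _ hr.1, E.card_roots_specialize hD]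
      simp
  have h2 := (E.mem_roots_specialize hD).2 hy
  rw [← h1] at h2
  obtain ⟨i, -, hi⟩ := Finset.mem_image.1 h2
  exact ⟨i, hi⟩

theorem IsEnumeration.comp_perm {E : SeparableEquation m} {r : Fin E.Q.natDegree → ℂ}
    (hr : E.IsEnumeration t r) (σ : Equiv.Perm (Fin E.Q.natDegree)) : E.IsEnumeration t (r ∘ σ) :=
  ⟨hr.1.comp σ.injective, fun i => hr.2 (σ i)⟩

theorem IsEnumeration.exists_perm {E : SeparableEquation m} (hD : MvPolynomial.aeval t E.D ≠ 0)
    {r s : Fin E.Q.natDegree → ℂ} (hr : E.IsEnumeration t r) (hs : E.IsEnumeration t s) :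
    ∃ σ : Equiv.Perm (Fin E.Q.natDegree), s = r ∘ σ := by
  choose f hf using fun i => hr.exists_eq hD (hs.2 i)
  have hinj : Function.Injective f := fun i j h => hs.1 (by rw [← hf i, ← hf j, h])
  exact ⟨Equiv.ofBijective f (Finite.injective_iff_bijective.1 hinj), funext fun i => (hf i).symm⟩

/-! ### The inverse of the fundamental matrix -/

/-- The entries of the inverse of the Vandermonde matrix of the roots. -/
def rootInv (t : Fin m → ℂ) (y : ℂ) (j : ℕ) : ℂ :=
  evalPair t y E.b / MvPolynomial.aeval t E.c * ∑ k ∈ Finset.Icc (j + 1) E.Q.natDegree,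
    y ^ (k - (j + 1)) * MvPolynomial.aeval t (E.Q.coeff k)

/-- Lagrange interpolation: the left side is `h(x) / Q_y(t, y)` for the quotient `h` of `Q(t, ·)` by
`X - y`, whose coefficients are the Horner sums in `rootInv`. Using `b / c` for `1 / Q_y` keeps the
inverse Vandermonde entries explicit and easy to bound. -/
theorem sum_rootInv_mul_pow (hD : MvPolynomial.aeval t E.D ≠ 0) {x : ℂ}
    (hy : evalPair t y E.Q = 0) (hx : evalPair t x E.Q = 0) :
    ∑ j : Fin E.Q.natDegree, E.rootInv t y j * x ^ (j : ℕ) = if y = x then 1 else 0 := by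
  obtain ⟨h, hh⟩ : ∃ h, h = E.specialize t /ₘ (Polynomial.X - Polynomial.C y) := ⟨_, rfl⟩
  have hroot : (E.specialize t).IsRoot y := by rw [Polynomial.IsRoot.def, eval_specialize, hy]
  have hmul : (Polynomial.X - Polynomial.C y) * h = E.specialize t := by
    rw [hh]
    exact Polynomial.mul_divByMonic_eq_iff_isRoot.2 hroot
  have hdeg : h.natDegree < E.Q.natDegree := by
    rw [hh, Polynomial.natDegree_divByMonic _ (Polynomial.monic_X_sub_C y),
      E.natDegree_specialize hD, Polynomial.natDegree_X_sub_C]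
    have := E.two_le
    omega
  have hsum : ∑ j : Fin E.Q.natDegree, E.rootInv t y j * x ^ (j : ℕ) =
      evalPair t y E.b / MvPolynomial.aeval t E.c * h.eval x := by
    rw [Polynomial.eval_eq_sum_range' hdeg, Finset.sum_range, Finset.mul_sum]
    refine Finset.sum_congr rfl fun j _ => ?_
    rw [hh, Polynomial.coeff_divByMonic_X_sub_C, E.natDegree_specialize hD, rootInv, mul_assoc]
    simp only [specialize, Polynomial.coeff_map]
    rfl
  rw [hsum]
  have hc := aeval_ne_zero_of_dvd E.c_dvd hD
  split_ifs with hxy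
  · subst hxy
    have h1 : h.eval y = evalPair t y (Polynomial.derivative E.Q) := by
      rw [← eval_derivative_specialize, ← hmul]
      simp
    rw [h1, div_mul_eq_mul_div, E.b_mul_derivative hy, div_self hc]
  · have h1 : (x - y) * h.eval x = 0 := by
      have := congrArg (Polynomial.eval x) hmul
      rw [eval_specialize, hx] at this
      simpa using this
    rw [(mul_eq_zero.1 h1).resolve_left (sub_ne_zero.2 (Ne.symm hxy)), mul_zero]

/-- The inverse of `fullFrame`. -/
def fullFrameInv (t : Fin m → ℂ) (r : Fin E.Q.natDegree → ℂ) : Matrix E.Idx E.Idx ℂ :=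
  Matrix.fromBlocks (Matrix.of fun i j => E.rootInv t (r i) j) 0 0
    (unipotentFrameInv (fun j => E.poleFun j t) (∑ k, t k))

theorem fullFrameInv_mul (hD : MvPolynomial.aeval t E.D ≠ 0) {r : Fin E.Q.natDegree → ℂ}
    (hr : E.IsEnumeration t r) : E.fullFrameInv t r * E.fullFrame t r = 1 := by
  rw [fullFrameInv, fullFrame, Matrix.fromBlocks_multiply, ← Matrix.fromBlocks_one]
  congr 1
  · ext i j
    simp only [Matrix.zero_mul, add_zero, Matrix.mul_apply, Matrix.of_apply]
    rw [E.sum_rootInv_mul_pow hD (hr.2 i) (hr.2 j), Matrix.one_apply]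
    simp only [hr.1.eq_iff]
  · simp
  · simp
  · simp [unipotentFrameInv_mul]

/-! ### Growth -/

theorem polynomiallyBounded_aeval {α : Type*} {D : MvPolynomial (Fin m) ℚ} {τ : α → Fin m → ℂ}
    (p : MvPolynomial (Fin m) ℚ) :
    PolynomiallyBounded (fun x => CP.growth D (τ x)) fun x => MvPolynomial.aeval (τ x) p := by
  induction p using MvPolynomial.induction_on with
  | C c => simpa using polynomiallyBounded_const (algebraMap ℚ ℂ c)
  | add p q hp hq =>
    simp only [map_add]
    exact hp.add (fun x => CP.one_le_growth D _) hq
  | mul_X p k hp =>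
    simp only [map_mul, MvPolynomial.aeval_X]
    refine hp.mul ⟨1, 1, zero_le_one, fun x => ?_⟩
    simp only [one_mul, pow_one, CP.growth]
    have h1 := norm_le_pi_norm (τ x) k
    have h2 : 0 ≤ ‖MvPolynomial.aeval (τ x) D‖⁻¹ := by positivity
    linarith

theorem polynomiallyBounded_inv {α : Type*} {D p : MvPolynomial (Fin m) ℚ} {τ : α → Fin m → ℂ}
    (hp : p ∣ D) (hD : ∀ x, MvPolynomial.aeval (τ x) D ≠ 0) :
    PolynomiallyBounded (fun x => CP.growth D (τ x)) fun x => (MvPolynomial.aeval (τ x) p)⁻¹ := by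
  have h1 : PolynomiallyBounded (fun x => CP.growth D (τ x))
      fun x => (MvPolynomial.aeval (τ x) D)⁻¹ := by
    refine ⟨1, 1, zero_le_one, fun x => ?_⟩
    simp only [one_mul, pow_one, CP.growth, norm_inv]
    linarith [norm_nonneg (τ x)]
  obtain ⟨q, hq⟩ := hp
  have h2 := (polynomiallyBounded_aeval (D := D) (τ := τ) q).mul h1
  have e : (fun x => (MvPolynomial.aeval (τ x) p)⁻¹) =
      fun x => MvPolynomial.aeval (τ x) q * (MvPolynomial.aeval (τ x) D)⁻¹ := by
    funext x
    have h3 := hD x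
    have h4 : MvPolynomial.aeval (τ x) D =
      MvPolynomial.aeval (τ x) p * MvPolynomial.aeval (τ x) q := by rw [← map_mul, ← hq]
    rw [h4] at h3 ⊢
    have h5 := left_ne_zero_of_mul h3
    have h6 := right_ne_zero_of_mul h3
    field_simp
  rw [e]
  exact h2

/-- The points `(t, y)` with `Q(t, y) = 0` and `D(t) ≠ 0`. -/
abbrev Pts : Type :=
  {x : (Fin m → ℂ) × ℂ // MvPolynomial.aeval x.1 E.D ≠ 0 ∧ evalPair x.1 x.2 E.Q = 0}

/-- The growth scale on `Pts`. -/
def scale (x : E.Pts) : ℝ := CP.growth E.D x.1.1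

theorem one_le_scale (x : E.Pts) : 1 ≤ E.scale x := CP.one_le_growth _ _

theorem polynomiallyBounded_coeff (p : MvPolynomial (Fin m) ℚ) :
    PolynomiallyBounded E.scale fun x => MvPolynomial.aeval x.1.1 p :=
  polynomiallyBounded_aeval p

theorem polynomiallyBounded_coeff_inv {p : MvPolynomial (Fin m) ℚ} (hp : p ∣ E.D) :
    PolynomiallyBounded E.scale fun x => (MvPolynomial.aeval x.1.1 p)⁻¹ :=
  polynomiallyBounded_inv hp fun x => x.2.1

/-- The Cauchy bound for the roots. -/
theorem polynomiallyBounded_root : PolynomiallyBounded E.scale fun x => x.1.2 := by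
  have hlc := fun x : E.Pts => aeval_ne_zero_of_dvd E.leadingCoeff_dvd x.2.1
  have hb : PolynomiallyBounded E.scale fun x : E.Pts => (1 : ℂ) +
      ∑ i : Fin E.Q.natDegree, ((‖MvPolynomial.aeval x.1.1 (E.Q.coeff i)‖ : ℝ) : ℂ) *
        ((‖(MvPolynomial.aeval x.1.1 E.Q.leadingCoeff)⁻¹‖ : ℝ) : ℂ) := by
    refine (polynomiallyBounded_const 1).add E.one_le_scale
      (PolynomiallyBounded.sum E.one_le_scale _ fun i _ => ?_)
    exact (E.polynomiallyBounded_coeff _).ofReal_norm.mul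
      (E.polynomiallyBounded_coeff_inv E.leadingCoeff_dvd).ofReal_norm
  refine hb.mono fun x => ?_
  obtain ⟨B, hB⟩ : ∃ B : ℝ, B = ∑ i : Fin E.Q.natDegree,
    ‖MvPolynomial.aeval x.1.1 (E.Q.coeff i)‖ *
      ‖(MvPolynomial.aeval x.1.1 E.Q.leadingCoeff)⁻¹‖ := ⟨_, rfl⟩
  have hB0 : 0 ≤ B := hB ▸ Finset.sum_nonneg fun i _ => by positivity
  have e : ‖(1 : ℂ) + ∑ i : Fin E.Q.natDegree,
      ((‖MvPolynomial.aeval x.1.1 (E.Q.coeff i)‖ : ℝ) : ℂ) *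
        ((‖(MvPolynomial.aeval x.1.1 E.Q.leadingCoeff)⁻¹‖ : ℝ) : ℂ)‖ = 1 + B := by
    have : (1 : ℂ) + ∑ i : Fin E.Q.natDegree,
      ((‖MvPolynomial.aeval x.1.1 (E.Q.coeff i)‖ : ℝ) : ℂ) *
        ((‖(MvPolynomial.aeval x.1.1 E.Q.leadingCoeff)⁻¹‖ : ℝ) : ℂ) = ((1 + B : ℝ) : ℂ) := by
      rw [hB]
      push_cast
      rfl
    rw [this, Complex.norm_real, Real.norm_of_nonneg (by linarith)]
  rw [e]
  by_cases hy1 : ‖x.1.2‖ ≤ 1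
  · linarith
  push Not at hy1
  have hpos : 0 < ‖MvPolynomial.aeval x.1.1 E.Q.leadingCoeff‖ := norm_pos_iff.2 (hlc x)
  obtain ⟨d, hd⟩ : ∃ d, E.Q.natDegree = d + 1 := ⟨E.Q.natDegree - 1, by have := E.two_le; omega⟩
  have hQ := x.2.2
  rw [evalPair_eq_sum _ _ (Nat.lt_succ_self _), Fin.sum_univ_castSucc] at hQ
  simp only [Fin.val_castSucc, Fin.val_last] at hQ
  have h1 : MvPolynomial.aeval x.1.1 E.Q.leadingCoeff * x.1.2 ^ E.Q.natDegree =
      -∑ i : Fin E.Q.natDegree, MvPolynomial.aeval x.1.1 (E.Q.coeff i) * x.1.2 ^ (i : ℕ) := by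
    rw [Polynomial.leadingCoeff]
    linear_combination hQ
  have h2 : ‖MvPolynomial.aeval x.1.1 E.Q.leadingCoeff‖ * ‖x.1.2‖ ^ E.Q.natDegree ≤
      (B * ‖MvPolynomial.aeval x.1.1 E.Q.leadingCoeff‖) * ‖x.1.2‖ ^ d := by
    rw [← norm_pow, ← norm_mul, h1, norm_neg, hB, Finset.sum_mul, Finset.sum_mul]
    refine (norm_sum_le _ _).trans (Finset.sum_le_sum fun i _ => ?_)
    rw [norm_mul, norm_inv, inv_mul_cancel_right₀ hpos.ne', norm_pow]
    refine mul_le_mul_of_nonneg_left (pow_le_pow_right₀ hy1.le ?_) (norm_nonneg _)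
    have := i.2
    omega
  rw [hd, pow_succ] at h2
  have hpp : 0 < ‖MvPolynomial.aeval x.1.1 E.Q.leadingCoeff‖ * ‖x.1.2‖ ^ d := by positivity
  have h3 : ‖x.1.2‖ ≤ B := by
    refine le_of_mul_le_mul_left ?_ hpp
    calc _ = ‖MvPolynomial.aeval x.1.1 E.Q.leadingCoeff‖ * (‖x.1.2‖ ^ d * ‖x.1.2‖) := by ring
      _ ≤ _ := h2
      _ = _ := by ring
  linarith

theorem polynomiallyBounded_evalPair (P : Polynomial (MvPolynomial (Fin m) ℚ)) :
    PolynomiallyBounded E.scale fun x => evalPair x.1.1 x.1.2 P := by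
  simp only [evalPair_eq_sum _ _ (Nat.lt_succ_self P.natDegree)]
  exact PolynomiallyBounded.sum E.one_le_scale _ fun i _ =>
    (E.polynomiallyBounded_coeff _).mul (E.polynomiallyBounded_root.pow _)

theorem polynomiallyBounded_rootInv (j : ℕ) :
    PolynomiallyBounded E.scale fun x => E.rootInv x.1.1 x.1.2 j := by
  simp only [rootInv, div_eq_mul_inv]
  refine ((E.polynomiallyBounded_evalPair E.b).mul
    (E.polynomiallyBounded_coeff_inv E.c_dvd)).mul ?_
  exact PolynomiallyBounded.sum E.one_le_scale _ fun i _ =>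
    (E.polynomiallyBounded_root.pow _).mul (E.polynomiallyBounded_coeff _)

theorem polynomiallyBounded_poleFun (j : Fin (m + 1)) :
    PolynomiallyBounded E.scale fun x => E.poleFun j x.1.1 := by
  simp only [poleFun, div_eq_mul_inv]
  exact (E.polynomiallyBounded_coeff _).mul (E.polynomiallyBounded_coeff_inv dvd_rfl)

theorem polynomiallyBounded_coord_sum :
    PolynomiallyBounded E.scale fun x => ∑ k, x.1.1 k := by
  simpa using E.polynomiallyBounded_coeff (∑ k, MvPolynomial.X k)

theorem polynomiallyBounded_unipotentFrame (i j : Fin (m + 1) ⊕ Fin 2) :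
    PolynomiallyBounded E.scale fun x =>
      unipotentFrame (fun j => E.poleFun j x.1.1) (∑ k, x.1.1 k) i j := by
  rcases i with i | i <;> rcases j with j | j
  · exact polynomiallyBounded_const _
  · fin_cases j
    · exact E.polynomiallyBounded_poleFun i
    · exact E.polynomiallyBounded_coord_sum.mul (E.polynomiallyBounded_poleFun i)
  · exact polynomiallyBounded_const _
  · fin_cases i <;> fin_cases j
    · exact polynomiallyBounded_const _
    · exact E.polynomiallyBounded_coord_sum
    · exact polynomiallyBounded_const _
    · exact polynomiallyBounded_const _

theorem polynomiallyBounded_unipotentFrameInv (i j : Fin (m + 1) ⊕ Fin 2) :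
    PolynomiallyBounded E.scale fun x =>
      unipotentFrameInv (fun j => E.poleFun j x.1.1) (∑ k, x.1.1 k) i j := by
  rcases i with i | i <;> rcases j with j | j
  · exact polynomiallyBounded_const _
  · fin_cases j
    · exact (E.polynomiallyBounded_poleFun i).neg
    · exact polynomiallyBounded_const _
  · exact polynomiallyBounded_const _
  · fin_cases i <;> fin_cases j
    · exact polynomiallyBounded_const _
    · exact E.polynomiallyBounded_coord_sum.neg
    · exact polynomiallyBounded_const _
    · exact polynomiallyBounded_const _

theorem fullFrame_bound : ∃ (K : ℝ) (N : ℕ), ∀ t, MvPolynomial.aeval t E.D ≠ 0 →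
    ∀ r, E.IsEnumeration t r → ∀ i j, ‖E.fullFrame t r i j‖ ≤ K * CP.growth E.D t ^ N ∧
      ‖E.fullFrameInv t r i j‖ ≤ K * CP.growth E.D t ^ N := by
  obtain ⟨K, N, hK, h⟩ := PolynomiallyBounded.exists_uniform E.one_le_scale
    (ι := (Fin E.Q.natDegree ⊕ Fin E.Q.natDegree) ⊕
      ((Fin (m + 1) ⊕ Fin 2) × (Fin (m + 1) ⊕ Fin 2)) ⊕
        ((Fin (m + 1) ⊕ Fin 2) × (Fin (m + 1) ⊕ Fin 2)))
    (φ := Sum.elim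
      (Sum.elim (fun i x => x.1.2 ^ (i : ℕ)) fun i x => E.rootInv x.1.1 x.1.2 i)
      (Sum.elim
        (fun p x => unipotentFrame (fun j => E.poleFun j x.1.1) (∑ k, x.1.1 k) p.1 p.2)
        fun p x => unipotentFrameInv (fun j => E.poleFun j x.1.1) (∑ k, x.1.1 k) p.1 p.2))
    (by
      rintro ((i | i) | p | p)
      · exact E.polynomiallyBounded_root.pow _
      · exact E.polynomiallyBounded_rootInv _
      · exact E.polynomiallyBounded_unipotentFrame _ _
      · exact E.polynomiallyBounded_unipotentFrameInv _ _)
  refine ⟨K, N, fun t hD r hr => ?_⟩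
  have hpt : ∀ i, MvPolynomial.aeval t E.D ≠ 0 ∧ evalPair t (r i) E.Q = 0 := fun i => ⟨hD, hr.2 i⟩
  have h0 : 0 ≤ K * CP.growth E.D t ^ N :=
    mul_nonneg hK (pow_nonneg (zero_le_one.trans (CP.one_le_growth _ _)) _)
  have hd : 0 < E.Q.natDegree := by
    have := E.two_le
    omega
  rintro (i | i) (j | j)
  -- Roots index the columns of the frame but the rows of its inverse, so `i` and `j` swap roles.
  · exact ⟨h (Sum.inl (Sum.inl i)) ⟨(t, r j), hpt j⟩, h (Sum.inl (Sum.inr j)) ⟨(t, r i), hpt i⟩⟩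
  · simpa [fullFrame, fullFrameInv] using h0
  · simpa [fullFrame, fullFrameInv] using h0
  -- The unipotent entries depend on `t` alone; some root is needed only to name a point of `Pts`
  -- over `t`.
  · exact ⟨h (Sum.inr (Sum.inl (i, j))) ⟨(t, r ⟨0, hd⟩), hpt _⟩,
      h (Sum.inr (Sum.inr (i, j))) ⟨(t, r ⟨0, hd⟩), hpt _⟩⟩

end SeparableEquation

/-! ### The Q-system of a separable equation -/

namespace SeparableEquation

variable {m : ℕ} (E : SeparableEquation m) {t : Fin m → ℂ} {y : ℂ}

/-- The permutation matrix of `σ` on the Vandermonde block. -/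
def permBlock (σ : Equiv.Perm (Fin E.Q.natDegree)) : Matrix E.Idx E.Idx ℂ :=
  Matrix.fromBlocks ((1 : Matrix _ _ ℂ).submatrix id σ) 0 0 1

theorem fullFrame_mul_permBlock (r : Fin E.Q.natDegree → ℂ)
    (σ : Equiv.Perm (Fin E.Q.natDegree)) :
    E.fullFrame t r * E.permBlock σ = E.fullFrame t (r ∘ σ) := by
  rw [fullFrame, permBlock, Matrix.fromBlocks_multiply, fullFrame]
  congr 1
  · ext i j
    simp [Matrix.mul_apply, Matrix.one_apply]
  · simp
  · simp
  · simp

theorem permBlock_mul (σ τ : Equiv.Perm (Fin E.Q.natDegree)) :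
    E.permBlock σ * E.permBlock τ = E.permBlock (σ * τ) := by
  rw [permBlock, permBlock, Matrix.fromBlocks_multiply, permBlock]
  congr 1
  · ext i j
    simp [Matrix.one_apply, Equiv.symm_apply_eq]
  · simp
  · simp
  · simp

theorem permBlock_one : E.permBlock 1 = 1 := by
  rw [permBlock, Equiv.Perm.coe_one, Matrix.submatrix_id_id, Matrix.fromBlocks_one]

theorem permBlock_pow (σ : Equiv.Perm (Fin E.Q.natDegree)) (k : ℕ) :
    E.permBlock σ ^ k = E.permBlock (σ ^ k) := by
  induction k with
  | zero => rw [pow_zero, pow_zero, permBlock_one]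
  | succ k ih => rw [pow_succ, pow_succ, ih, permBlock_mul]

/-- The size of the system. -/
def size : ℕ := Fintype.card E.Idx

/-- The enumeration of the index set. -/
def idxEquiv : E.Idx ≃ Fin E.size := Fintype.equivFin E.Idx

/-- The system satisfied by the powers of the roots of `Q`, enlarged by the unipotent block. -/
def system : PfaffianSystem m E.size where
  coeff k := (E.fullCoeff k).submatrix E.idxEquiv.symm E.idxEquiv.symm

/-- Renaming of the index set. -/
def rename : Matrix E.Idx E.Idx ℂ ≃ₐ[ℂ] Matrix (Fin E.size) (Fin E.size) ℂ :=
  Matrix.reindexAlgEquiv ℂ ℂ E.idxEquiv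

theorem rename_apply (M : Matrix E.Idx E.Idx ℂ) (i j : Fin E.size) :
    E.rename M i j = M (E.idxEquiv.symm i) (E.idxEquiv.symm j) := rfl

/-- The fundamental matrices belonging to all enumerations of the roots. -/
def frames (t : Fin m → ℂ) : Set (Matrix (Fin E.size) (Fin E.size) ℂ) :=
  {V | ∃ r, E.IsEnumeration t r ∧ V = E.rename (E.fullFrame t r)}

/-- Simple roots continue holomorphically by the implicit function theorem and remain distinct
nearby, so they still exhaust the roots. -/
theorem exists_enumeration_section (hD : MvPolynomial.aeval t E.D ≠ 0)
    {r : Fin E.Q.natDegree → ℂ} (hr : E.IsEnumeration t r) :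
    ∃ f : Fin E.Q.natDegree → (Fin m → ℂ) → ℂ, (∀ i, f i t = r i) ∧
      ∀ᶠ t' in 𝓝 t, E.IsEnumeration t' (fun i => f i t') ∧
        E.system.AffineSolvesAt (fun t' => E.rename (E.fullFrame t' fun i => f i t')) t' ∧
        ∀ i, ContinuousAt (f i) t' := by
  choose f hft hf using fun i => exists_root_function (hr.2 i) (E.derivative_ne_zero hD (hr.2 i))
  refine ⟨f, hft, ?_⟩
  have hroot : ∀ᶠ t' in 𝓝 t, ∀ i, evalPair t' (f i t') E.Q = 0 ∧ DifferentiableAt ℂ (f i) t' :=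
    Filter.eventually_all.2 hf
  have hne : ∀ᶠ t' in 𝓝 t, ∀ i j, i ≠ j → f i t' ≠ f j t' := by
    refine Filter.eventually_all.2 fun i => Filter.eventually_all.2 fun j => ?_
    by_cases hij : i = j
    · exact Filter.Eventually.of_forall fun _ h => absurd hij h
    · have hc := fun i => (hf i).self_of_nhds.2.continuousAt
      have hij' : f i t ≠ f j t := by
        rw [hft, hft]
        exact hr.1.ne hij
      filter_upwards [((hc i).ne_iff_eventually_ne (hc j)).1 hij'] with t' ht' _
      exact ht'
  filter_upwards [hroot.eventually_nhds, hne,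
    PfaffianSystem.IsFrameField.eventually_aeval_ne_zero hD] with t' h1 h2 h3
  have h4 := h1.self_of_nhds
  refine ⟨⟨fun i j hij => by_contra fun h => h2 i j h hij, fun i => (h4 i).1⟩, fun i j => ?_,
    fun i => (h4 i).2.continuousAt⟩
  refine (E.hasFDerivAt_fullFrame h3 (fun a => h1.mono fun _ h => (h a).1) (fun a => (h4 a).2)
    (E.idxEquiv.symm i) (E.idxEquiv.symm j)).congr_fderiv ?_
  refine Finset.sum_congr rfl fun k _ => ?_
  congr 1
  exact (Equiv.sum_comp E.idxEquiv.symm fun l =>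
    (E.fullCoeff k (E.idxEquiv.symm i) l).value t' *
      E.fullFrame t' (fun a => f a t') l (E.idxEquiv.symm j)).symm

/-- With `G` the homogenization of `D` of degree `e`, the entry `poleFun j` of the unipotent block
gives the `dzₖ` coefficient `zⱼᵉ / (z₀ G)` for `k ≥ 1`. Its denominator vanishes on the whole cone,
and some numerator `zⱼᵉ` does not vanish at `z`. -/
theorem mem_polarLocus (z : Fin (m + 1) → ℂ) (hz : z ≠ 0) (hc : z ∈ CP.zeroCone E.D) :
    Projectivization.mk ℂ z hz ∈ E.system.polarLocus := by
  have hcoord : (RatFun.coord 0 : RatFun (m + 1)) ≠ 0 := fun h =>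
    MvPolynomial.X_ne_zero (R := ℚ) (0 : Fin (m + 1))
      (IsFractionRing.injective (MvPolynomial (Fin (m + 1)) ℚ) (RatFun (m + 1))
        (h.trans (map_zero _).symm))
  have hhom : homogenizePoly m E.D ≠ 0 := by
    rw [Ne, map_eq_zero_iff _ (homogenizePoly_injective m)]
    exact E.ne_zero
  obtain ⟨j, hj⟩ : ∃ j, z j ≠ 0 := by
    by_contra! h
    exact hz (funext h)
  -- For `m = 0` there is no `dtₖ` to carry a pole, but then `D` is a nonzero constant and the cone
  -- contains only `0`.
  obtain ⟨k⟩ : Nonempty (Fin m) := by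
    by_contra hm
    rw [not_nonempty_iff] at hm
    rcases hc with hc | hc
    · have : j = 0 := by
        refine Fin.cases rfl (fun k => (IsEmpty.false k).elim) j
      exact hj (this ▸ hc)
    · apply E.ne_zero
      rw [MvPolynomial.eq_C_of_isEmpty E.D] at hc ⊢
      rw [MvPolynomial.aeval_C, map_eq_zero] at hc
      rw [hc, map_zero]
  refine ⟨z, hz, rfl, k.succ, E.idxEquiv (Sum.inr (Sum.inl j)),
    E.idxEquiv (Sum.inr (Sum.inr 1)), ?_⟩
  have hentry : E.system.homCoeff k.succ (E.idxEquiv (Sum.inr (Sum.inl j)))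
      (E.idxEquiv (Sum.inr (Sum.inr 1))) = homogenize m (algebraMap _ (RatFun m) (E.numer j) /
        algebraMap _ (RatFun m) E.D) / RatFun.coord 0 := by
    simp [PfaffianSystem.homCoeff, system, fullCoeff, unipotentCoeff]
  rw [hentry]
  have hnum : RatFun.coord 0 ^ E.deg * homogenizePoly m (E.numer j) =
      algebraMap (MvPolynomial (Fin (m + 1)) ℚ) (RatFun (m + 1)) (MvPolynomial.X j ^ E.deg) := by
    refine Fin.cases ?_ (fun k => ?_) j
    · simp only [numer, Fin.cases_zero, map_one, mul_one, map_pow]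
      rfl
    · simp only [numer, Fin.cases_succ, map_pow]
      rw [homogenizePoly, MvPolynomial.aeval_X, ← mul_pow, mul_div_cancel₀ _ hcoord]
      rfl
  refine RatFun.not_regularAt_of_mul_eq (a := MvPolynomial.X j ^ E.deg)
    (b := MvPolynomial.X 0 * E.hom) ?_ ?_ (by simpa using fun h => absurd h hj)
  · rw [map_mul, algebraMap_hom, map_div₀, RatFun.homogenize_algebraMap,
      RatFun.homogenize_algebraMap, ← hnum]
    change _ * (RatFun.coord 0 * _) = _
    field_simp
  · rw [map_mul, MvPolynomial.aeval_X]
    by_cases h0 : z 0 = 0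
    · rw [h0, zero_mul]
    · rw [CP.aeval_homogenization E.algebraMap_hom h0, hc.resolve_left h0, mul_zero, mul_zero]

/-- `Γ` consists of the permutation matrices of the roots, extended by the identity on the unipotent
block, whose fundamental matrix does not depend on the enumeration. -/
theorem isFrameField : E.system.IsFrameField E.D E.frames
    (Set.range fun σ => E.rename (E.permBlock σ)) where
  ne_zero := E.ne_zero
  regularAt t hD k i j := E.regularAt_fullCoeff hD k _ _
  nonempty t hD := by
    obtain ⟨r, hr⟩ := E.exists_isEnumeration hD
    exact ⟨_, r, hr, rfl⟩
  det_ne_zero := by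
    rintro t hD _ ⟨r, hr, rfl⟩
    refine Matrix.det_ne_zero_of_left_inverse (B := E.rename (E.fullFrameInv t r)) ?_
    rw [← map_mul, E.fullFrameInv_mul hD hr, map_one]
  exists_section := by
    rintro t hD _ ⟨r, hr, rfl⟩
    obtain ⟨f, hft, hf⟩ := E.exists_enumeration_section hD hr
    refine ⟨fun t' => E.rename (E.fullFrame t' fun i => f i t'), by simp only [hft], ?_⟩
    filter_upwards [hf] with t' h
    exact ⟨⟨_, h.1, rfl⟩, h.2.1⟩
  mul_mem := by
    rintro t _ ⟨r, hr, rfl⟩ _ ⟨σ, rfl⟩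
    refine ⟨r ∘ σ, hr.comp_perm σ, ?_⟩
    rw [← map_mul, fullFrame_mul_permBlock]
  exists_mul := by
    rintro t hD _ ⟨r, hr, rfl⟩ _ ⟨s, hs, rfl⟩
    obtain ⟨σ, rfl⟩ := hr.exists_perm hD hs
    exact ⟨_, ⟨σ, rfl⟩, by rw [← map_mul, fullFrame_mul_permBlock]⟩
  finite_order := by
    rintro _ ⟨σ, rfl⟩
    refine ⟨orderOf σ, orderOf_pos σ, ?_⟩
    rw [← map_pow, permBlock_pow, pow_orderOf_eq_one, permBlock_one, map_one]
  bound := by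
    obtain ⟨K, N, h⟩ := E.fullFrame_bound
    refine ⟨K, N, ?_⟩
    rintro t hD _ ⟨r, hr, rfl⟩ i j
    have hinv : (E.rename (E.fullFrame t r))⁻¹ = E.rename (E.fullFrameInv t r) := by
      refine Matrix.inv_eq_left_inv ?_
      rw [← map_mul, E.fullFrameInv_mul hD hr, map_one]
    rw [hinv]
    exact h t hD r hr _ _
  mem_polarLocus := E.mem_polarLocus

end SeparableEquation

/-! ### Branches of the function as entries of the fundamental matrix -/

theorem MultivaluedFunction.continuousAt_toFun {m : ℕ} (F : MultivaluedFunction.{u} m) (e : F.space)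
    {t : Fin m → ℂ} (ht : F.proj e = CP.affine t) : ContinuousAt F.toFun e := by
  obtain ⟨g, hg, hFg⟩ := F.holomorphic e
  have hproj : ContinuousAt F.proj e := F.isLocalHomeomorph.continuous.continuousAt
  have h1 := (hg (Fin.cons 1 t) (CP.cons_one_ne_zero t) ht.symm).continuousAt
  have h2 : ContinuousAt (fun t => g (CP.affine t)) t := by
    have := ContinuousAt.comp (f := fun t : Fin m → ℂ => (Fin.cons 1 t : Fin (m + 1) → ℂ))
      (x := t) h1 CP.continuous_cons_one.continuousAt
    refine this.congr (Filter.Eventually.of_forall fun t' => ?_)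
    exact CP.pullback_apply g (CP.cons_one_ne_zero t')
  have h3 : ContinuousAt g (F.proj e) := by
    rw [ht, ContinuousAt, ← CP.map_affine_nhds, Filter.tendsto_map'_iff]
    exact h2
  exact (h3.comp hproj).congr hFg.symm

end

theorem proposition3 (m : ℕ) (F : MultivaluedFunction.{u} m) (hF : F.IsAlgebraicOverRat) :
    F.IsQFunction := by
  obtain ⟨P, hP, hPF⟩ := hF
  obtain ⟨E, hE⟩ := exists_separableEquation hP
  have hframe := E.isFrameField
  obtain ⟨i₁, hi₁⟩ : ∃ i : Fin E.Q.natDegree, (i : ℕ) = 1 :=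
    ⟨⟨1, by have := E.two_le; omega⟩, rfl⟩
  -- The coefficients `c` must be the same for all branches. So the column `i₀` is fixed in advance,
  -- and at each point the roots are enumerated so that the current branch comes in this column; row
  -- `i₁` holds first powers.
  obtain ⟨i₀, -⟩ : ∃ i : Fin E.Q.natDegree, (i : ℕ) = 0 :=
    ⟨⟨0, by have := E.two_le; omega⟩, rfl⟩
  refine ⟨E.size, E.system, hframe.isQSystem,
    fun i j => if i = E.idxEquiv (Sum.inl i₁) ∧ j = E.idxEquiv (Sum.inl i₀) then 1 else 0,
    fun e he => ?_⟩
  obtain ⟨t, ht, hD⟩ := hframe.exists_affine_of_notMem he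
  have hroot : evalPair t (F.toFun e) E.Q = 0 := hE t _ hD (hPF e t ht)
  obtain ⟨r, hr, hr₀⟩ : ∃ r, E.IsEnumeration t r ∧ r i₀ = F.toFun e := by
    obtain ⟨r, hr⟩ := E.exists_isEnumeration hD
    obtain ⟨i, hi⟩ := hr.exists_eq hD hroot
    exact ⟨r ∘ Equiv.swap i₀ i, hr.comp_perm _, by simp [hi]⟩
  obtain ⟨f, hft, hf⟩ := E.exists_enumeration_section hD hr
  have hS : ∀ᶠ t' in 𝓝 t, E.rename (E.fullFrame t' fun i => f i t') ∈ E.frames t' ∧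
      E.system.AffineSolvesAt (fun t' => E.rename (E.fullFrame t' fun i => f i t')) t' :=
    hf.mono fun t' h => ⟨⟨_, h.1, rfl⟩, h.2.1⟩
  refine ⟨fun p => E.rename (E.fullFrame p.coords fun i => f i p.coords),
    ht ▸ hframe.isFundamentalNear_section hD hS, ?_⟩
  have hproj : Filter.Tendsto F.proj (𝓝 e) (𝓝 (CP.affine t)) :=
    ht ▸ F.isLocalHomeomorph.continuous.continuousAt
  have hFc := F.continuousAt_toFun e ht
  have hcoords : ContinuousAt (CP.coords : CP m → Fin m → ℂ) (CP.affine t) := by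
    rw [ContinuousAt, ← CP.map_affine_nhds, Filter.tendsto_map'_iff, CP.coords_affine]
    exact Filter.tendsto_id.congr fun t' => (CP.coords_affine t').symm
  -- Near `e` the value of `F` is one of the continued roots; by continuity it stays away from those
  -- that differ from it at `e`, so it must be the root with index `i₀`.
  have hsep : ∀ᶠ e' in 𝓝 e, ∀ i, i ≠ i₀ → f i (F.proj e').coords ≠ F.toFun e' := by
    refine Filter.eventually_all.2 fun i => ?_
    by_cases hi : i = i₀
    · exact Filter.Eventually.of_forall fun _ h => absurd hi h
    · have hc : ContinuousAt (fun e' => f i (F.proj e').coords) e := by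
        have h1 : Filter.Tendsto (fun e' => (F.proj e').coords) (𝓝 e) (𝓝 t) := by
          have := hcoords.tendsto.comp hproj
          rwa [CP.coords_affine] at this
        have h2 := (hf.self_of_nhds.2.2 i).tendsto.comp h1
        rw [ContinuousAt, ht, CP.coords_affine]
        exact h2
      have hne : f i (F.proj e).coords ≠ F.toFun e := by
        rw [ht, CP.coords_affine, hft, ← hr₀]
        exact hr.1.ne hi
      filter_upwards [(hc.ne_iff_eventually_ne hFc).1 hne] with e' he' _
      exact he'
  have haff := hproj.eventually (CP.eventually_nhds_affine (Q := fun q => ∃ t', q = CP.affine t' ∧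
      MvPolynomial.aeval t' E.D ≠ 0 ∧ E.IsEnumeration t' fun i => f i t')|>.2 (by
    filter_upwards [hf, PfaffianSystem.IsFrameField.eventually_aeval_ne_zero hD] with t' h1 h2
    exact ⟨t', rfl, h2, h1.1⟩))
  filter_upwards [hsep, haff] with e' h1 h2
  obtain ⟨t', ht', hD', hen⟩ := h2
  have hc' : (F.proj e').coords = t' := by rw [ht', CP.coords_affine]
  rw [hc'] at h1 ⊢
  obtain ⟨i, hi⟩ := hen.exists_eq hD' (hE t' _ hD' (hPF e' t' ht'))
  have hii : i = i₀ := by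
    by_contra h
    exact h1 i h hi
  subst hii
  simp only [ite_and, ite_mul, one_mul, zero_mul, Finset.sum_ite_eq', Finset.mem_univ, if_true,
    Finset.sum_ite_irrel, Finset.sum_const_zero]
  rw [E.rename_apply, Equiv.symm_apply_apply, Equiv.symm_apply_apply]
  simp [SeparableEquation.fullFrame, hi₁, hi]
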